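/- **Setting.** Let $\mathcal A$ be a finite non-empty set with $a$ elements and $\mathcal B$ a finite set. A privacy protocol is a random function $\mathcal Q\colon\mathcal A\to\mathcal B$; let $Q\in\mathbb R^{\mathcal B\times\mathcal A}$, $Q_{y|x}=\mathbb P(\mathcal Q(x)=y)$, be its matrix. Assume that $Q_{y|x}>0$ for all $x,y$ and that $Q$ has rank $a$. Let $\mathcal P_{\mathcal A}=\{p\in\mathbb R_{\ge 0}^{\mathcal A}:\sum_x p_x=1\}$ and let $\mu$ be a Borel probability measure on $\mathcal P_{\mathcal A}$ (the prior). Draw $P\sim\mu$; given $P=p$, let the private data $X_1,X_2,\dots$ be i.i.d. with law $p$, and let $Y_i=\mathcal Q(X_i)$, with independent randomisations for different $i$. For $n\ge 0$ write $\vec Y=(Y_1,\dots,Y_n)$. For $\vec y\in\mathcal B^n$ let $s_\beta(\vec y)=\#\{i:y_i=\beta\}$. A maximum likelihood estimator $\Pi_{\mathrm{MLE}}$ assigns to every $n$ and every $\vec y\in\mathcal B^n$ a maximiser over $p\in\mathcal P_{\mathcal A}$ of $\mathbb P(\vec Y=\vec y\mid P=p)$. An estimator $\Pi\colon\mathcal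 B^n\to\mathbb R^{\mathcal A}$ is optimal if it minimises $\mathbb E\,\|P-\Pi(\vec Y)\|_2^2$ among all maps $\mathcal B^n\to\mathbb R^{\mathcal A}$. **Theorem.** 1. Maximum likelihood estimators exist. For each $n$ there is exactly one optimal estimator $\Pi_{\mathrm{opt}}$, namely the posterior mean $\Pi_{\mathrm{opt}}(\vec y)=\mathbb E[P\mid\vec Y=\vec y]$. For every choice of maximum likelihood estimator, $\Pi_{\mathrm{MLE}}(\vec Y)-\Pi_{\mathrm{opt}}(\vec Y)\to 0$ in probability as $n\to\infty$, both under the joint law of $(P,\vec Y)$ and, for every $p$ in the support of $\mu$, under the conditional law of $\vec Y$ given $P=p$. 2. The set $\mathcal P_{\mathcal A}$ has affine dimension $a-1$. For all $n$ and $\vec y\in\mathcal B^n$ the function $$f_{\vec y}(p)=-\sum_{\beta\in\mathcal B}s_\beta(\vec y)\log\big((Qp)_\beta\big)$$ is convex on the convex set $\mathcal P_{\mathcal A}$, and $p\in\mathcal P_{\mathcal A}$ is a maximum likelihood estimate for $\vec y$ if and only if it minimises $f_{\vec y}$ over $\mathcal P_{\mathcal A}$. 3. The complexity of this convex problem does not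 depend on $n$: for fixed $\mathcal A,\mathcal B$ there is a single real-number program (unit-cost integer constants, $+,-,\times,\div$, and branching and looping on comparisons, with no division by zero) that takes as input an accuracy $\varepsilon>0$, the matrix $Q$ and the tallies $(s_\beta(\vec y))_{\beta\in\mathcal B}$ and such that for every $Q$ as above and every $\varepsilon>0$ there is a number $T$ with the following property. For all $n$ and all $\vec y\in\mathcal B^n$ the program halts after at most $T$ elementary operations and outputs a point $\hat p\in\mathcal P_{\mathcal A}$ with $$f_{\vec y}(\hat p)-\min_{\mathcal P_{\mathcal A}}f_{\vec y}\le\varepsilon\Big(\max_{\mathcal P_{\mathcal A}}f_{\vec y}-\min_{\mathcal P_{\mathcal A}}f_{\vec y}\Big).$$ -/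

import Mathlib

open MeasureTheory ProbabilityTheory Filter Topology

namespace LDP

noncomputable section

/-! ### Privacy protocols and the sampling model -/

/-- A privacy protocol, i.e. a random function from `A` to `B`, given by its matrix of transition
probabilities: `mat y x` is the probability that the input `x` is randomised to the output `y`. -/
structure PrivacyProtocol (A B : Type*) [Fintype B] where
  /-- the transition matrix -/
  mat : Matrix B A ℝ
  mat_nonneg : ∀ y x, 0 ≤ mat y x
  sum_mat : ∀ x, ∑ y, mat y x = 1

/-- The two standing assumptions on a protocol: all transition probabilities are strictly positive,
and the transition matrix has rank `#A`. -/
structure PrivacyProtocol.IsRegular {A B : Type*} [Fintype A] [Fintype B]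
    (Q : PrivacyProtocol A B) : Prop where
  mat_pos : ∀ y x, 0 < Q.mat y x
  rank_eq : Q.mat.rank = Fintype.card A

section Model

variable {A B : Type*} [Fintype A] [Fintype B] [MeasurableSpace A] [MeasurableSpace B]

/-- The law of the pair `(X, Y)` of one user, where `X` is drawn from the distribution `p` and
`Y = Q(X)`. -/
def userLaw (Q : PrivacyProtocol A B) (p : stdSimplex ℝ A) : Measure (A × B) :=
  ∑ x, ∑ y, ENNReal.ofReal (p.1 x * Q.mat y x) • Measure.dirac (x, y)

instance userLaw_isProbabilityMeasure (Q : PrivacyProtocol A B) (p : stdSimplex ℝ A) :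
    IsProbabilityMeasure (userLaw Q p) := by
  constructor
  have h0 : ∀ x y, 0 ≤ p.1 x * Q.mat y x := fun x y => mul_nonneg (p.2.1 x) (Q.mat_nonneg y x)
  simp only [userLaw, Measure.coe_finsetSum, Finset.sum_apply, Measure.smul_apply,
    measure_univ, smul_eq_mul, mul_one]
  simp_rw [← ENNReal.ofReal_sum_of_nonneg (fun y _ => h0 _ y), ← Finset.mul_sum, Q.sum_mat, mul_one]
  rw [← ENNReal.ofReal_sum_of_nonneg (fun x _ => p.2.1 x), p.2.2, ENNReal.ofReal_one]

theorem measurable_infinitePi_userLaw (Q : PrivacyProtocol A B) :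
    Measurable fun p : stdSimplex ℝ A => Measure.infinitePi fun _ : ℕ => userLaw Q p := by
  refine Measurable.measure_of_isPiSystem_of_isProbabilityMeasure
    (generateFrom_squareCylinders (α := fun _ : ℕ => A × B)).symm
    (isPiSystem_squareCylinders (fun _ => MeasurableSpace.isPiSystem_measurableSet)
      fun _ => by simp) ?_
  rintro _ ⟨s, t, ht, rfl⟩
  have ht' : ∀ i, MeasurableSet (t i) := fun i => ht i (Set.mem_univ i)
  simp_rw [Measure.infinitePi_pi _ (fun i _ => ht' i)]
  refine Finset.measurable_fun_prod s fun i _ => ?_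
  simp only [userLaw, Measure.coe_finsetSum, Finset.sum_apply, Measure.smul_apply, smul_eq_mul]
  refine Finset.measurable_fun_sum _ fun x _ => Finset.measurable_fun_sum _ fun y _ => ?_
  have hx : Measurable fun p : stdSimplex ℝ A => p.1 x :=
    (measurable_pi_apply x).comp measurable_subtype_coe
  exact ((hx.mul_const _).ennreal_ofReal).mul_const _

/-- Given `P = p`, the pairs `(X_i, Y_i)` of private and perturbed data of the users `i = 0, 1, …`
are independent, each with law `userLaw Q p`. -/
def dataKernel (Q : PrivacyProtocol A B) : Kernel (stdSimplex ℝ A) (ℕ → A × B) where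
  toFun p := Measure.infinitePi fun _ => userLaw Q p
  measurable' := measurable_infinitePi_userLaw Q

instance dataKernel_isMarkovKernel (Q : PrivacyProtocol A B) :
    IsMarkovKernel (dataKernel Q) :=
  ⟨fun p => inferInstanceAs
    (IsProbabilityMeasure (Measure.infinitePi fun _ : ℕ => userLaw Q p))⟩

/-- The joint law of the true distribution `P`, which is drawn from the prior `μ`, and the data
`(X_i, Y_i)` of all users. -/
def jointLaw (Q : PrivacyProtocol A B) (μ : Measure (stdSimplex ℝ A)) :
    Measure (stdSimplex ℝ A × (ℕ → A × B)) :=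
  μ ⊗ₘ dataKernel Q

/-- The perturbed data `(Y_0, …, Y_{n-1})` of the first `n` users. -/
def perturbed {A B : Type*} (n : ℕ) (w : ℕ → A × B) : Fin n → B := fun i => (w i).2

/-! ### Estimators of `P` -/

/-- The mean squared error `𝔼 ‖P - Π(Y)‖₂²` of an estimator `est` for `n` users. -/
def mse (Q : PrivacyProtocol A B) (μ : Measure (stdSimplex ℝ A)) (n : ℕ)
    (est : (Fin n → B) → A → ℝ) : ℝ :=
  ∫ ω, ∑ x, (ω.1.1 x - est (perturbed n ω.2) x) ^ 2 ∂(jointLaw Q μ)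

/-- An estimator of `P` is optimal if it minimises the mean squared error. -/
def IsOptimalEstimator (Q : PrivacyProtocol A B) (μ : Measure (stdSimplex ℝ A)) (n : ℕ)
    (est : (Fin n → B) → A → ℝ) : Prop :=
  ∀ est' : (Fin n → B) → A → ℝ, mse Q μ n est ≤ mse Q μ n est'

/-- The posterior mean `𝔼[P | Y = y]`. -/
def posteriorMean (Q : PrivacyProtocol A B) (μ : Measure (stdSimplex ℝ A)) (n : ℕ)
    (y : Fin n → B) : A → ℝ :=
  fun x => ∫ ω, ω.1.1 x ∂(ProbabilityTheory.cond (jointLaw Q μ) {ω | perturbed n ω.2 = y})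

/-- The likelihood `ℙ(Y = y | P = p)`. -/
def likelihood (Q : PrivacyProtocol A B) {n : ℕ} (y : Fin n → B) (p : stdSimplex ℝ A) : ℝ :=
  (dataKernel Q p).real {w | perturbed n w = y}

/-- `p` is a maximum likelihood estimate of `P` given `y`. -/
def IsMLE (Q : PrivacyProtocol A B) {n : ℕ} (y : Fin n → B) (p : stdSimplex ℝ A) : Prop :=
  ∀ p' : stdSimplex ℝ A, likelihood Q y p' ≤ likelihood Q y p

end Model

/-! ### The optimisation problem -/

open Classical in
/-- The number of users whose perturbed data item is `β`. -/
def tally {B : Type*} {n : ℕ} (y : Fin n → B) (β : B) : ℕ :=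
  (Finset.univ.filter fun i => y i = β).card

/-- The objective function `p ↦ -∑ β, s_β log (Q p)_β`. -/
def objective {A B : Type*} [Fintype A] [Fintype B] (Q : PrivacyProtocol A B) (s : B → ℕ)
    (p : A → ℝ) : ℝ :=
  -∑ β, (s β : ℝ) * Real.log ((Q.mat.mulVec p) β)

/-- `x` solves the problem of minimising `f` on `D` with relative accuracy `ε`: its excess over the
minimum is at most the fraction `ε` of the variation of `f` on `D`. This notion does not
change when `f` is multiplied by a positive constant. -/
def IsApproxMinimizer {E : Type*} (ε : ℝ) (D : Set E) (f : E → ℝ) (x : E) : Prop :=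
  x ∈ D ∧ f x - sInf (f '' D) ≤ ε * (sSup (f '' D) - sInf (f '' D))

/-! ### Real-number programs and their running time -/

/-- Programs over registers holding real numbers: integer constants, the four arithmetic
operations, and branching and looping on comparisons. -/
inductive RealProgram (R : Type*) where
  | const (x : R) (c : ℤ)
  | add (x y z : R)
  | sub (x y z : R)
  | mul (x y z : R)
  | div (x y z : R)
  | seq (c d : RealProgram R)
  | branch (x y : R) (c d : RealProgram R)
  | loop (x y : R) (c : RealProgram R)

open Classical in
/-- `c.RunsIn σ τ t`: started with register contents `σ`, the program `c` halts with register
contents `τ` after exactly `t` elementary operations (constant assignments, arithmetic operations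
and comparisons). A division by zero does not halt. -/
inductive RealProgram.RunsIn {R : Type*} : RealProgram R → (R → ℝ) → (R → ℝ) → ℕ → Prop where
  | const (x : R) (c : ℤ) (σ : R → ℝ) :
      RunsIn (.const x c) σ (Function.update σ x (c : ℝ)) 1
  | add (x y z : R) (σ : R → ℝ) :
      RunsIn (.add x y z) σ (Function.update σ x (σ y + σ z)) 1
  | sub (x y z : R) (σ : R → ℝ) :
      RunsIn (.sub x y z) σ (Function.update σ x (σ y - σ z)) 1
  | mul (x y z : R) (σ : R → ℝ) :
      RunsIn (.mul x y z) σ (Function.update σ x (σ y * σ z)) 1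
  | div (x y z : R) (σ : R → ℝ) (hz : σ z ≠ 0) :
      RunsIn (.div x y z) σ (Function.update σ x (σ y / σ z)) 1
  | seq (c d : RealProgram R) (σ τ υ : R → ℝ) (t u : ℕ)
      (hc : RunsIn c σ τ t) (hd : RunsIn d τ υ u) :
      RunsIn (.seq c d) σ υ (t + u)
  | branch_true (x y : R) (c d : RealProgram R) (σ τ : R → ℝ) (t : ℕ)
      (h : σ x ≤ σ y) (hc : RunsIn c σ τ t) :
      RunsIn (.branch x y c d) σ τ (t + 1)
  | branch_false (x y : R) (c d : RealProgram R) (σ τ : R → ℝ) (t : ℕ)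
      (h : ¬ σ x ≤ σ y) (hd : RunsIn d σ τ t) :
      RunsIn (.branch x y c d) σ τ (t + 1)
  | loop_true (x y : R) (c : RealProgram R) (σ τ υ : R → ℝ) (t u : ℕ)
      (h : σ x ≤ σ y) (hc : RunsIn c σ τ t) (hl : RunsIn (.loop x y c) τ υ u) :
      RunsIn (.loop x y c) σ υ (t + u + 1)
  | loop_false (x y : R) (c : RealProgram R) (σ : R → ℝ) (h : ¬ σ x ≤ σ y) :
      RunsIn (.loop x y c) σ σ 1

/-- Registers of a program that computes an estimate: the input consists of the desired accuracy,
the matrix of the protocol and the tallies, the output is a vector indexed by `A`, and there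
are countably many work registers. -/
inductive Register (A B : Type*) where
  | accuracy
  | protocol (y : B) (x : A)
  | tally (β : B)
  | output (x : A)
  | work (k : ℕ)

/-- The initial register contents. -/
def initialState {A B : Type*} [Fintype B] (Q : PrivacyProtocol A B) (s : B → ℕ) (ε : ℝ) :
    Register A B → ℝ
  | .accuracy => ε
  | .protocol y x => Q.mat y x
  | .tally β => s β
  | .output _ => 0
  | .work _ => 0

end

end LDP

/-! Consistency. The likelihood is `exp(-f)`, and `f` is `n` times the cross entropy of the observed
frequencies relative to `Q p`. Under a true `p₀` the frequencies tend almost surely to `Q p₀`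
(strong law, `ae_tendsto_frequency`). Because the logarithms are bounded on the simplex, the cross
entropies then converge uniformly, and the limit has `p₀` as its only minimiser, by Gibbs'
inequality and injectivity of `Q` (`crossEntropy_lt`). So the minimisers tend to `p₀`
(`tendsto_of_minimizes`), and so does the posterior mean if `p₀` lies in the support of the prior
(Laplace's method, `tendsto_gibbs_integral`). The two estimators merge because they have the same
limit. Optimality of the posterior mean is the completion of a square on each event `Y = y`;
uniqueness holds because all these events have positive probability.

Complexity. The Frank-Wolfe method needs only the gradient of `f`, which is rational in `Q`, the
tallies and `p`, so it runs on a real-number machine without logarithms. Its error after `k` steps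
is at most `4C / (k + 2)`, with `C` a curvature constant. Both curvature and variation of `f` grow
with the tallies, but their ratio is controlled by `Q` alone: both are compared with sums `∑ s_β
(Q_βx - Q_βz)²`. With `r` the sum of the inverse entries of `Q` and `V` the variation, `C = 8 r² V`
is admissible, so more than `32 r² / ε` steps suffice, whatever the tallies are. -/

namespace LDP

/-! ### Bounds on `Q p` and convexity of the objective -/

section Optimisation

theorem PrivacyProtocol.mat_le_one {A B : Type*} [Fintype B]
    (Q : PrivacyProtocol A B) (β : B) (x : A) : Q.mat β x ≤ 1 := by
  rw [← Q.sum_mat x]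
  exact Finset.single_le_sum (f := fun y => Q.mat y x) (fun y _ => Q.mat_nonneg y x)
    (Finset.mem_univ β)

variable {A B : Type*} [Fintype A] [Fintype B] {Q : PrivacyProtocol A B}

/-- The sum of the inverses of all transition probabilities. -/
noncomputable def PrivacyProtocol.invSum (Q : PrivacyProtocol A B) : ℝ :=
  ∑ β, ∑ x, 1 / Q.mat β x

theorem PrivacyProtocol.invSum_nonneg (Q : PrivacyProtocol A B) : 0 ≤ Q.invSum :=
  Finset.sum_nonneg fun β _ => Finset.sum_nonneg fun x _ => one_div_nonneg.2 (Q.mat_nonneg β x)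

/-- A lower bound on the entries in division-free form. A sum of inverses replaces the minimal entry
because the program can evaluate it as one arithmetic expression. -/
theorem PrivacyProtocol.IsRegular.one_le_invSum_mul_mat (hQ : Q.IsRegular) (β : B) (x : A) :
    1 ≤ Q.invSum * Q.mat β x := by
  have h0 : ∀ y x, 0 ≤ 1 / Q.mat y x := fun y x => one_div_nonneg.2 (Q.mat_nonneg y x)
  have h : 1 / Q.mat β x ≤ Q.invSum :=
    (Finset.single_le_sum (f := fun x => 1 / Q.mat β x) (fun x _ => h0 β x)
      (Finset.mem_univ x)).trans
      (Finset.single_le_sum (f := fun β => ∑ x, 1 / Q.mat β x)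
        (fun β _ => Finset.sum_nonneg fun x _ => h0 β x) (Finset.mem_univ β))
  rwa [div_le_iff₀ (hQ.mat_pos β x)] at h

theorem PrivacyProtocol.IsRegular.one_le_invSum_mul_mulVec (hQ : Q.IsRegular) (β : B) {p : A → ℝ}
    (hp : p ∈ stdSimplex ℝ A) : 1 ≤ Q.invSum * Q.mat.mulVec p β := by
  simp only [Matrix.mulVec, dotProduct, Finset.mul_sum]
  rw [← hp.2]
  refine Finset.sum_le_sum fun x _ => ?_
  nlinarith [hQ.one_le_invSum_mul_mat β x, hp.1 x]

theorem PrivacyProtocol.IsRegular.mulVec_pos (hQ : Q.IsRegular) (β : B) {p : A → ℝ}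
    (hp : p ∈ stdSimplex ℝ A) : 0 < Q.mat.mulVec p β := by
  have h := hQ.one_le_invSum_mul_mulVec β hp
  by_contra! h'
  nlinarith [mul_nonneg Q.invSum_nonneg (neg_nonneg.2 h')]

theorem PrivacyProtocol.mulVec_le_one (Q : PrivacyProtocol A B) (β : B) {p : A → ℝ}
    (hp : p ∈ stdSimplex ℝ A) : Q.mat.mulVec p β ≤ 1 := by
  simp only [Matrix.mulVec, dotProduct]
  rw [← hp.2]
  refine Finset.sum_le_sum fun x _ => ?_
  nlinarith [Q.mat_le_one β x, hp.1 x]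

theorem PrivacyProtocol.sum_mulVec (Q : PrivacyProtocol A B) {p : A → ℝ}
    (hp : p ∈ stdSimplex ℝ A) : ∑ β, Q.mat.mulVec p β = 1 := by
  simp only [Matrix.mulVec, dotProduct]
  rw [Finset.sum_comm, ← hp.2]
  exact Finset.sum_congr rfl fun x _ => by rw [← Finset.sum_mul, Q.sum_mat, one_mul]

theorem PrivacyProtocol.IsRegular.mulVec_injective (hQ : Q.IsRegular) :
    Function.Injective Q.mat.mulVec := by
  rw [Matrix.mulVec_injective_iff, linearIndependent_iff_card_eq_finrank_span, ← hQ.rank_eq,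
    Matrix.rank_eq_finrank_span_cols]
  rfl

theorem PrivacyProtocol.IsRegular.continuousOn_log_mulVec (hQ : Q.IsRegular) (β : B) :
    ContinuousOn (fun p => Real.log (Q.mat.mulVec p β)) (stdSimplex ℝ A) := by
  refine ContinuousOn.log ?_ fun p hp => (hQ.mulVec_pos β hp).ne'
  have : Continuous fun p : A → ℝ => Q.mat.mulVec p β := by
    simp only [Matrix.mulVec, dotProduct]
    fun_prop
  exact this.continuousOn

theorem PrivacyProtocol.IsRegular.continuousOn_objective (hQ : Q.IsRegular) (s : B → ℕ) :
    ContinuousOn (objective Q s) (stdSimplex ℝ A) :=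
  (continuousOn_finsetSum _ fun β _ =>
    continuousOn_const.mul (hQ.continuousOn_log_mulVec β)).neg

theorem PrivacyProtocol.IsRegular.convexOn_objective (hQ : Q.IsRegular) (s : B → ℕ) :
    ConvexOn ℝ (stdSimplex ℝ A) (objective Q s) := by
  refine ⟨convex_stdSimplex ℝ A, fun p hp q hq a b ha hb hab => ?_⟩
  simp only [objective, smul_eq_mul, mul_neg, Finset.mul_sum, ← Finset.sum_neg_distrib,
    ← Finset.sum_add_distrib]
  refine Finset.sum_le_sum fun β _ => ?_
  have h := strictConcaveOn_log_Ioi.concaveOn.2 (hQ.mulVec_pos β hp) (hQ.mulVec_pos β hq) ha hb hab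
  rw [Matrix.mulVec_add, Matrix.mulVec_smul, Matrix.mulVec_smul]
  simp only [Pi.add_apply, Pi.smul_apply, smul_eq_mul] at h ⊢
  nlinarith [mul_le_mul_of_nonneg_left h (Nat.cast_nonneg (α := ℝ) (s β))]

/-! ### Lower bounds on the variation of the objective -/

/-- The variation of a function on a set. -/
noncomputable def variation {E : Type*} (D : Set E) (f : E → ℝ) : ℝ := sSup (f '' D) - sInf (f '' D)

theorem sInf_objective_le (hQ : Q.IsRegular) (s : B → ℕ) {p : A → ℝ} (hp : p ∈ stdSimplex ℝ A) :
    sInf (objective Q s '' stdSimplex ℝ A) ≤ objective Q s p :=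
  csInf_le ((isCompact_stdSimplex ℝ A).image_of_continuousOn
    (hQ.continuousOn_objective s)).bddBelow ⟨p, hp, rfl⟩

theorem objective_sub_le_variation (hQ : Q.IsRegular) (s : B → ℕ) {p q : A → ℝ}
    (hp : p ∈ stdSimplex ℝ A) (hq : q ∈ stdSimplex ℝ A) :
    objective Q s p - objective Q s q ≤ variation (stdSimplex ℝ A) (objective Q s) :=
  sub_le_sub (le_csSup ((isCompact_stdSimplex ℝ A).image_of_continuousOn
    (hQ.continuousOn_objective s)).bddAbove ⟨p, hp, rfl⟩) (sInf_objective_le hQ s hq)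

/-- Strong concavity of the logarithm on `(0, 1]`. With `m` the midpoint, the right side is half of
`log (m² / (u v))`; apply `log t ≥ 1 - 1/t` and `u + v ≤ 2`. -/
theorem sq_sub_div_eight_le_log {u v : ℝ} (hu : 0 < u) (hv : 0 < v) (hu1 : u ≤ 1) (hv1 : v ≤ 1) :
    (u - v) ^ 2 / 8 ≤ Real.log ((u + v) / 2) - (Real.log u + Real.log v) / 2 := by
  have huv : 0 < u + v := by positivity
  have hw : (0 : ℝ) < (u + v) / 2 := by positivity
  have h := Real.one_sub_inv_le_log_of_pos (x := ((u + v) / 2) ^ 2 / (u * v)) (by positivity)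
  rw [Real.log_div (by positivity) (by positivity), Real.log_pow, Real.log_mul hu.ne' hv.ne'] at h
  have h2 : 1 - (((u + v) / 2) ^ 2 / (u * v))⁻¹ = (u - v) ^ 2 / (u + v) ^ 2 := by
    field_simp
    ring
  have h3 : (u - v) ^ 2 / 4 ≤ (u - v) ^ 2 / (u + v) ^ 2 :=
    div_le_div_of_nonneg_left (sq_nonneg _) (by positivity) (by nlinarith)
  push_cast at h
  linarith

-- At the midpoint of two vertices the objective falls below the average of the vertex values by at
-- most the variation, and strong concavity of the logarithm bounds this drop from below.
open Classical in
theorem sum_mul_sq_sub_le_variation (hQ : Q.IsRegular) (s : B → ℕ) (x z : A) :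
    ∑ β, (s β : ℝ) * (Q.mat β x - Q.mat β z) ^ 2 ≤
      8 * variation (stdSimplex ℝ A) (objective Q s) := by
  have hx := single_mem_stdSimplex ℝ x
  have hz := single_mem_stdSimplex ℝ z
  have hm : (1 / 2 : ℝ) • Pi.single (M := fun _ => ℝ) x 1 + (1 / 2 : ℝ) • Pi.single z 1
      ∈ stdSimplex ℝ A :=
    convex_stdSimplex ℝ A hx hz (by norm_num) (by norm_num) (by norm_num)
  have h1 := objective_sub_le_variation hQ s hx hm
  have h2 := objective_sub_le_variation hQ s hz hm
  have h3 : ∑ β, (s β : ℝ) * ((Q.mat β x - Q.mat β z) ^ 2 / 8) ≤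
      (objective Q s (Pi.single x 1) + objective Q s (Pi.single z 1)) / 2 -
      objective Q s ((1 / 2 : ℝ) • Pi.single x 1 + (1 / 2 : ℝ) • Pi.single z 1) := by
    have : (objective Q s (Pi.single x 1) + objective Q s (Pi.single z 1)) / 2 -
      objective Q s ((1 / 2 : ℝ) • Pi.single x 1 + (1 / 2 : ℝ) • Pi.single z 1) =
      ∑ β, (s β : ℝ) * (Real.log ((Q.mat β x + Q.mat β z) / 2) -
        (Real.log (Q.mat β x) + Real.log (Q.mat β z)) / 2) := by
      simp only [objective, Matrix.mulVec_add, Matrix.mulVec_smul, Matrix.mulVec_single_one,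
        Matrix.col_apply, Pi.add_apply, Pi.smul_apply, smul_eq_mul]
      rw [sub_neg_eq_add, div_eq_mul_inv, ← neg_add, neg_mul, neg_add_eq_sub,
        ← Finset.sum_add_distrib, Finset.sum_mul, ← Finset.sum_sub_distrib]
      refine Finset.sum_congr rfl fun β _ => ?_
      rw [← mul_add, one_div, inv_mul_eq_div]
      ring
    rw [this]
    exact Finset.sum_le_sum fun β _ => mul_le_mul_of_nonneg_left
      (sq_sub_div_eight_le_log (hQ.mat_pos β x) (hQ.mat_pos β z) (Q.mat_le_one β x)
        (Q.mat_le_one β z)) (Nat.cast_nonneg _)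
  simp only [← mul_div_assoc, ← Finset.sum_div] at h3
  linarith

theorem sum_mul_sq_sub_mulVec_le_variation (hQ : Q.IsRegular) (s : B → ℕ) (z : A) {p : A → ℝ}
    (hp : p ∈ stdSimplex ℝ A) :
    ∑ β, (s β : ℝ) * (Q.mat β z - Q.mat.mulVec p β) ^ 2 ≤
      8 * variation (stdSimplex ℝ A) (objective Q s) := by
  -- Jensen's inequality for the square reduces a general point to the vertices.
  have hsq : ∀ β, (Q.mat β z - Q.mat.mulVec p β) ^ 2 ≤
      ∑ x, p x * (Q.mat β x - Q.mat β z) ^ 2 := by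
    intro β
    have h := (even_two.convexOn_pow (𝕜 := ℝ)).map_sum_le (t := Finset.univ) (w := p)
      (p := fun x => Q.mat β x - Q.mat β z) (fun x _ => hp.1 x) hp.2 (fun _ _ => Set.mem_univ _)
    simp only [smul_eq_mul, mul_sub, Finset.sum_sub_distrib, ← Finset.sum_mul, hp.2] at h
    refine le_trans (le_of_eq ?_) h
    rw [← neg_sq, neg_sub, one_mul]
    congr 2
    exact Finset.sum_congr rfl fun x _ => mul_comm _ _
  calc ∑ β, (s β : ℝ) * (Q.mat β z - Q.mat.mulVec p β) ^ 2
      ≤ ∑ β, (s β : ℝ) * ∑ x, p x * (Q.mat β x - Q.mat β z) ^ 2 :=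
        Finset.sum_le_sum fun β _ => mul_le_mul_of_nonneg_left (hsq β) (Nat.cast_nonneg _)
    _ = ∑ x, p x * ∑ β, (s β : ℝ) * (Q.mat β x - Q.mat β z) ^ 2 := by
        simp only [Finset.mul_sum]
        rw [Finset.sum_comm]
        exact Finset.sum_congr rfl fun x _ => Finset.sum_congr rfl fun β _ => by ring
    _ ≤ ∑ x, p x * (8 * variation (stdSimplex ℝ A) (objective Q s)) :=
        Finset.sum_le_sum fun x _ => mul_le_mul_of_nonneg_left
          (sum_mul_sq_sub_le_variation hQ s x z) (hp.1 x)
    _ = 8 * variation (stdSimplex ℝ A) (objective Q s) := by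
        rw [← Finset.sum_mul, hp.2, one_mul]

/-! ### The Frank-Wolfe step and its rate -/

/-- The negative of the partial derivative of the objective in the direction `x`. -/
noncomputable def descent (Q : PrivacyProtocol A B) (s : B → ℝ) (p : A → ℝ) (x : A) : ℝ :=
  ∑ β, s β * Q.mat β x / ∑ x', Q.mat β x' * p x'

theorem descent_eq (s : B → ℝ) (p : A → ℝ) (x : A) :
    descent Q s p x = ∑ β, s β * Q.mat β x / Q.mat.mulVec p β := rfl

theorem sum_mul_descent (s : B → ℝ) (p q : A → ℝ) :
    ∑ x, q x * descent Q s p x = ∑ β, s β * Q.mat.mulVec q β / Q.mat.mulVec p β := by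
  simp only [descent_eq, Finset.mul_sum]
  rw [Finset.sum_comm]
  refine Finset.sum_congr rfl fun β _ => ?_
  simp only [Matrix.mulVec, dotProduct, Finset.mul_sum, Finset.sum_div]
  exact Finset.sum_congr rfl fun x _ => by ring

/-- The duality gap: `log t ≤ t - 1` at `t = (Q q)_β / (Q p)_β` bounds the excess by a linear
function of `q`, which is largest at the best vertex `z`. -/
theorem objective_sub_le_descent (hQ : Q.IsRegular) (s : B → ℕ) {p q : A → ℝ}
    (hp : p ∈ stdSimplex ℝ A) (hq : q ∈ stdSimplex ℝ A) {z : A}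
    (hz : ∀ x, descent Q (fun β => s β) p x ≤ descent Q (fun β => s β) p z) :
    objective Q s p - objective Q s q ≤ descent Q (fun β => s β) p z - ∑ β, (s β : ℝ) := by
  have h1 : ∑ x, q x * descent Q (fun β => s β) p x ≤ descent Q (fun β => s β) p z := by
    calc _ ≤ ∑ x, q x * descent Q (fun β => s β) p z :=
          Finset.sum_le_sum fun x _ => mul_le_mul_of_nonneg_left (hz x) (hq.1 x)
      _ = _ := by rw [← Finset.sum_mul, hq.2, one_mul]
  rw [sum_mul_descent] at h1
  refine le_trans ?_ (sub_le_sub_right h1 _)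
  simp only [objective, neg_sub_neg, ← Finset.sum_sub_distrib]
  refine Finset.sum_le_sum fun β _ => ?_
  have hpp := hQ.mulVec_pos β hp
  have hqp := hQ.mulVec_pos β hq
  have := Real.log_le_sub_one_of_pos (div_pos hqp hpp)
  rw [Real.log_div hqp.ne' hpp.ne'] at this
  have := mul_le_mul_of_nonneg_left this (Nat.cast_nonneg (α := ℝ) (s β))
  rw [mul_div_assoc]
  linarith

/-- From `log t ≥ 1 - 1/t` at `t = v / u`: the remainder is exactly `(v - u)² / (u v)`, and both
points are at least `1 / r`. -/
theorem neg_log_le_quadratic {u v r : ℝ} (hu : 0 < u) (hv : 0 < v) (hur : 1 ≤ r * u)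
    (hvr : 1 ≤ r * v) :
    -Real.log v ≤ -Real.log u - (v - u) / u + r ^ 2 * (v - u) ^ 2 := by
  have h := Real.one_sub_inv_le_log_of_pos (div_pos hv hu)
  rw [Real.log_div hv.ne' hu.ne', inv_div] at h
  have h1 : 1 - u / v = (v - u) / u - (v - u) ^ 2 / (u * v) := by
    field_simp
    ring
  have h2 : (v - u) ^ 2 / (u * v) ≤ r ^ 2 * (v - u) ^ 2 := by
    rw [div_le_iff₀ (by positivity)]
    have : 1 ≤ (r * u) * (r * v) := by nlinarith
    nlinarith [mul_le_mul_of_nonneg_left this (sq_nonneg (v - u))]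
  linarith

open Classical in
/-- The move from `p` towards the vertex `z` of the simplex. -/
noncomputable def moveTowards (γ : ℝ) (p : A → ℝ) (z : A) : A → ℝ :=
  fun x => (1 - γ) * p x + γ * if x = z then 1 else 0

theorem moveTowards_mem {γ : ℝ} (h0 : 0 ≤ γ) (h1 : γ ≤ 1) {p : A → ℝ} (hp : p ∈ stdSimplex ℝ A)
    (z : A) : moveTowards γ p z ∈ stdSimplex ℝ A := by
  constructor
  · intro x
    have := hp.1 x
    have : 0 ≤ 1 - γ := by linarith
    unfold moveTowards
    positivity
  · classical
    simp [moveTowards, Finset.sum_add_distrib, ← Finset.mul_sum, hp.2]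

theorem mulVec_moveTowards (γ : ℝ) (p : A → ℝ) (z : A) (β : B) :
    Q.mat.mulVec (moveTowards γ p z) β =
      Q.mat.mulVec p β + γ * (Q.mat β z - Q.mat.mulVec p β) := by
  classical
  simp only [Matrix.mulVec, dotProduct, moveTowards, mul_add, Finset.sum_add_distrib,
    mul_ite, mul_one, mul_zero, Finset.sum_ite_eq', Finset.mem_univ, if_true, mul_left_comm _ (1 - γ),
    ← Finset.mul_sum]
  ring

/-- One step of the Frank-Wolfe method. -/
theorem objective_moveTowards_le (hQ : Q.IsRegular) (s : B → ℕ) {p q : A → ℝ}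
    (hp : p ∈ stdSimplex ℝ A) (hq : q ∈ stdSimplex ℝ A) {z : A}
    (hz : ∀ x, descent Q (fun β => s β) p x ≤ descent Q (fun β => s β) p z)
    {γ : ℝ} (h0 : 0 ≤ γ) (h1 : γ ≤ 1) :
    objective Q s (moveTowards γ p z) - objective Q s q ≤
      (1 - γ) * (objective Q s p - objective Q s q) +
        γ ^ 2 * (8 * Q.invSum ^ 2 * variation (stdSimplex ℝ A) (objective Q s)) := by
  have hm := moveTowards_mem h0 h1 hp z
  -- The quadratic bound for each `β`, where the move changes `(Q p)_β` by `γ (Q_βz - (Q p)_β)`.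
  have hstep : objective Q s (moveTowards γ p z) ≤ objective Q s p -
      γ * (descent Q (fun β => s β) p z - ∑ β, (s β : ℝ)) +
      γ ^ 2 * (Q.invSum ^ 2 * ∑ β, (s β : ℝ) * (Q.mat β z - Q.mat.mulVec p β) ^ 2) := by
    simp only [objective, descent_eq, Finset.mul_sum, ← Finset.sum_sub_distrib,
      ← Finset.sum_add_distrib, ← Finset.sum_neg_distrib]
    refine Finset.sum_le_sum fun β _ => ?_
    have hpp := hQ.mulVec_pos β hp
    have h := neg_log_le_quadratic hpp (hQ.mulVec_pos β hm)
      (hQ.one_le_invSum_mul_mulVec β hp) (hQ.one_le_invSum_mul_mulVec β hm)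
    have h2 := mul_le_mul_of_nonneg_left h (Nat.cast_nonneg (α := ℝ) (s β))
    rw [mul_neg] at h2
    refine h2.trans (le_of_eq ?_)
    rw [mulVec_moveTowards]
    field_simp
    ring
  have hgap := mul_le_mul_of_nonneg_left (objective_sub_le_descent hQ s hp hq hz) h0
  have hvar := mul_le_mul_of_nonneg_left (mul_le_mul_of_nonneg_left
    (sum_mul_sq_sub_mulVec_le_variation hQ s z hp) (sq_nonneg Q.invSum)) (sq_nonneg γ)
  linarith

/-- The convergence rate of the Frank-Wolfe method with step sizes `2 / (k + 2)`. -/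
theorem frankWolfe_rate {C h h' : ℝ} {k : ℕ} (hC : 0 ≤ C)
    (hk : 1 ≤ k → h ≤ 4 * C / (k + 2))
    (hstep : h' ≤ (1 - 2 / ((k : ℝ) + 2)) * h + (2 / ((k : ℝ) + 2)) ^ 2 * C) :
    h' ≤ 4 * C / (((k + 1 : ℕ) : ℝ) + 2) := by
  have hk0 : (0 : ℝ) ≤ k := Nat.cast_nonneg k
  have e : (1 : ℝ) - 2 / (k + 2) = k / (k + 2) := by field_simp; ring
  have h1 : (k : ℝ) / (k + 2) * h ≤ k / (k + 2) * (4 * C / (k + 2)) := by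
    -- For `k = 0` the step size is `1` and the old error has weight zero, so the starting point
    -- needs no bound.
    rcases Nat.eq_zero_or_pos k with rfl | h0
    · simp
    · exact mul_le_mul_of_nonneg_left (hk h0) (by positivity)
  rw [e] at hstep
  refine (hstep.trans (add_le_add_left h1 _)).trans ?_
  have : (k : ℝ) / (k + 2) * (4 * C / (k + 2)) + (2 / ((k : ℝ) + 2)) ^ 2 * C =
      4 * C * ((k + 1) / (k + 2) ^ 2) := by
    field_simp
    ring
  rw [this]
  have h2 : ((k : ℝ) + 1) / (k + 2) ^ 2 ≤ 1 / (((k + 1 : ℕ) : ℝ) + 2) := by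
    push_cast
    rw [div_le_div_iff₀ (by positivity) (by positivity)]
    nlinarith
  calc 4 * C * (((k : ℝ) + 1) / (k + 2) ^ 2) ≤ 4 * C * (1 / (((k + 1 : ℕ) : ℝ) + 2)) :=
        mul_le_mul_of_nonneg_left h2 (by positivity)
    _ = _ := by ring

end Optimisation

end LDP

namespace LDP

/-! ### Arithmetic expressions and Hoare-style reasoning about programs -/

section Programs

/-- Arithmetic expressions over registers. -/
inductive RealExpr (R : Type*) where
  | reg (r : R)
  | const (c : ℤ)
  | add (e f : RealExpr R)
  | sub (e f : RealExpr R)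
  | mul (e f : RealExpr R)
  | div (e f : RealExpr R)

namespace RealExpr

variable {R : Type*}

/-- The value of an expression. -/
noncomputable def eval (ρ : R → ℝ) : RealExpr R → ℝ
  | reg r => ρ r
  | const c => c
  | add e f => eval ρ e + eval ρ f
  | sub e f => eval ρ e - eval ρ f
  | mul e f => eval ρ e * eval ρ f
  | div e f => eval ρ e / eval ρ f

/-- No division by zero occurs in the evaluation of the expression. -/
def Defined (ρ : R → ℝ) : RealExpr R → Prop
  | reg _ => True
  | const _ => True
  | add e f => Defined ρ e ∧ Defined ρ f
  | sub e f => Defined ρ e ∧ Defined ρ f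
  | mul e f => Defined ρ e ∧ Defined ρ f
  | div e f => Defined ρ e ∧ Defined ρ f ∧ eval ρ f ≠ 0

/-- The number of operations that the compiled expression needs. -/
def cost : RealExpr R → ℕ
  | reg _ => 2
  | const _ => 1
  | add e f => cost e + cost f + 1
  | sub e f => cost e + cost f + 1
  | mul e f => cost e + cost f + 1
  | div e f => cost e + cost f + 1

/-- The sum of a list of expressions. -/
def listSum : List (RealExpr R) → RealExpr R
  | [] => const 0
  | e :: l => add e (listSum l)

/-- The sum of a finite family of expressions. -/
noncomputable def sum {ι : Type*} [Fintype ι] (f : ι → RealExpr R) : RealExpr R :=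
  listSum (Finset.univ.toList.map f)

theorem eval_listSum (ρ : R → ℝ) (l : List (RealExpr R)) :
    (listSum l).eval ρ = (l.map (eval ρ)).sum := by
  induction l with
  | nil => simp [listSum, eval]
  | cons e l ih => simp [listSum, eval, ih]

theorem defined_listSum (ρ : R → ℝ) (l : List (RealExpr R)) (h : ∀ e ∈ l, e.Defined ρ) :
    (listSum l).Defined ρ := by
  induction l with
  | nil => trivial
  | cons e l ih => exact ⟨h e (by simp), ih fun e he => h e (by simp [he])⟩

theorem eval_sum {ι : Type*} [Fintype ι] (ρ : R → ℝ) (f : ι → RealExpr R) :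
    (sum f).eval ρ = ∑ i, (f i).eval ρ := by
  rw [sum, eval_listSum, List.map_map, ← Finset.sum_map_toList]
  rfl

theorem defined_sum {ι : Type*} [Fintype ι] {ρ : R → ℝ} {f : ι → RealExpr R}
    (h : ∀ i, (f i).Defined ρ) : (sum f).Defined ρ :=
  defined_listSum ρ _ fun e he => by
    obtain ⟨i, -, rfl⟩ := List.mem_map.1 he
    exact h i

end RealExpr

variable {A B : Type*}

/-- The registers that are visible to structured programs; the other ones are scratch registers. -/
def Register.main : Register A B → Register A B
  | .work k => .work (2 * k)
  | r => r

/-- The registers used for intermediate results in the evaluation of expressions. -/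
def Register.scratch (k : ℕ) : Register A B := .work (2 * k + 1)

theorem Register.main_injective : Function.Injective (Register.main (A := A) (B := B)) := by
  intro r r' h
  cases r <;> cases r' <;> simp_all [Register.main]

theorem Register.main_ne_scratch (r : Register A B) (k : ℕ) : r.main ≠ Register.scratch k := by
  cases r <;> simp [Register.main, Register.scratch]
  omega

theorem Register.scratch_inj {j k : ℕ} :
    (Register.scratch j : Register A B) = Register.scratch k ↔ j = k := by
  simp [Register.scratch]

/-- The program that computes an expression into the scratch register `k`, using the scratch
registers from `k` on. -/
def RealExpr.compile : RealExpr (Register A B) → ℕ → RealProgram (Register A B)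
  -- There is no copy instruction; a register is copied by adding it to zero.
  | .reg r, k => .seq (.const (.scratch k) 0) (.add (.scratch k) r.main (.scratch k))
  | .const c, k => .const (.scratch k) c
  | .add e f, k => .seq (.seq (e.compile k) (f.compile (k + 1)))
      (.add (.scratch k) (.scratch k) (.scratch (k + 1)))
  | .sub e f, k => .seq (.seq (e.compile k) (f.compile (k + 1)))
      (.sub (.scratch k) (.scratch k) (.scratch (k + 1)))
  | .mul e f, k => .seq (.seq (e.compile k) (f.compile (k + 1)))
      (.mul (.scratch k) (.scratch k) (.scratch (k + 1)))
  | .div e f, k => .seq (.seq (e.compile k) (f.compile (k + 1)))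
      (.div (.scratch k) (.scratch k) (.scratch (k + 1)))

/-- The last clause carries the induction: the left operand, held in scratch register `k`, survives
the evaluation of the right operand, which starts at `k + 1`. -/
theorem RealExpr.compile_spec (e : RealExpr (Register A B)) (k : ℕ) (σ : Register A B → ℝ)
    (h : e.Defined (σ ∘ Register.main)) :
    ∃ τ, (e.compile k).RunsIn σ τ e.cost ∧ τ (.scratch k) = e.eval (σ ∘ Register.main) ∧
      (∀ r : Register A B, τ r.main = σ r.main) ∧
      ∀ j < k, τ (.scratch j) = σ (.scratch j) := by
  classical
  have binary : ∀ (e f : RealExpr (Register A B)) (k : ℕ) (σ : Register A B → ℝ)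
      (_ : ∀ k σ, e.Defined (σ ∘ Register.main) →
        ∃ τ, (e.compile k).RunsIn σ τ e.cost ∧ τ (.scratch k) = e.eval (σ ∘ Register.main) ∧
        (∀ r : Register A B, τ r.main = σ r.main) ∧ ∀ j < k, τ (.scratch j) = σ (.scratch j))
      (_ : ∀ k σ, f.Defined (σ ∘ Register.main) →
        ∃ τ, (f.compile k).RunsIn σ τ f.cost ∧ τ (.scratch k) = f.eval (σ ∘ Register.main) ∧
        (∀ r : Register A B, τ r.main = σ r.main) ∧ ∀ j < k, τ (.scratch j) = σ (.scratch j)),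
      e.Defined (σ ∘ Register.main) → f.Defined (σ ∘ Register.main) →
      ∃ τ, (RealProgram.seq (e.compile k) (f.compile (k + 1))).RunsIn σ τ (e.cost + f.cost) ∧
        τ (.scratch k) = e.eval (σ ∘ Register.main) ∧
        τ (.scratch (k + 1)) = f.eval (σ ∘ Register.main) ∧
        (∀ r : Register A B, τ r.main = σ r.main) ∧
        ∀ j < k, τ (.scratch j) = σ (.scratch j) := by
    intro e f k σ ihe ihf he hf
    obtain ⟨τ, h1, h2, h3, h4⟩ := ihe k σ he
    have hm : τ ∘ Register.main = σ ∘ Register.main := funext h3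
    obtain ⟨υ, g1, g2, g3, g4⟩ := ihf (k + 1) τ (by rwa [hm])
    refine ⟨υ, .seq _ _ _ _ _ _ _ h1 g1, ?_, ?_, fun r => (g3 r).trans (h3 r),
      fun j hj => (g4 j (by omega)).trans (h4 j hj)⟩
    · rw [g4 k (by omega), h2]
    · rw [g2, hm]
  have upd : ∀ (τ : Register A B → ℝ) (k : ℕ) (v : ℝ),
      (∀ r : Register A B, Function.update τ (.scratch k) v r.main = τ r.main) ∧
      ∀ j < k, Function.update τ (.scratch k) v (.scratch j) = τ (.scratch j) := fun τ k v =>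
    ⟨fun r => Function.update_of_ne (Register.main_ne_scratch r k) _ _,
      fun j hj => Function.update_of_ne (fun h => hj.ne (Register.scratch_inj.1 h)) _ _⟩
  induction e generalizing k σ with
  | reg r =>
    refine ⟨_, .seq _ _ _ _ _ _ _ (.const _ _ _) (.add _ _ _ _), ?_, fun r' => ?_, fun j hj => ?_⟩
    · simp [RealExpr.eval, Function.update_of_ne (Register.main_ne_scratch r k)]
    · rw [(upd _ _ _).1, (upd _ _ _).1]
    · rw [(upd _ _ _).2 j hj, (upd _ _ _).2 j hj]
  | const c =>
    exact ⟨_, .const _ _ _, by simp [RealExpr.eval], (upd _ _ _).1, (upd _ _ _).2⟩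
  | add e f ihe ihf =>
    obtain ⟨τ, h1, h2, h3, h4, h5⟩ := binary e f k σ ihe ihf h.1 h.2
    refine ⟨_, .seq _ _ _ _ _ _ _ h1 (.add _ _ _ _), ?_, fun r => ?_, fun j hj => ?_⟩
    · simp [RealExpr.eval, h2, h3]
    · rw [(upd _ _ _).1, h4]
    · rw [(upd _ _ _).2 j hj, h5 j hj]
  | sub e f ihe ihf =>
    obtain ⟨τ, h1, h2, h3, h4, h5⟩ := binary e f k σ ihe ihf h.1 h.2
    refine ⟨_, .seq _ _ _ _ _ _ _ h1 (.sub _ _ _ _), ?_, fun r => ?_, fun j hj => ?_⟩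
    · simp [RealExpr.eval, h2, h3]
    · rw [(upd _ _ _).1, h4]
    · rw [(upd _ _ _).2 j hj, h5 j hj]
  | mul e f ihe ihf =>
    obtain ⟨τ, h1, h2, h3, h4, h5⟩ := binary e f k σ ihe ihf h.1 h.2
    refine ⟨_, .seq _ _ _ _ _ _ _ h1 (.mul _ _ _ _), ?_, fun r => ?_, fun j hj => ?_⟩
    · simp [RealExpr.eval, h2, h3]
    · rw [(upd _ _ _).1, h4]
    · rw [(upd _ _ _).2 j hj, h5 j hj]
  | div e f ihe ihf =>
    obtain ⟨τ, h1, h2, h3, h4, h5⟩ := binary e f k σ ihe ihf h.1 h.2.1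
    refine ⟨_, .seq _ _ _ _ _ _ _ h1 (.div _ _ _ _ (by rw [h3]; exact h.2.2)), ?_,
      fun r => ?_, fun j hj => ?_⟩
    · simp [RealExpr.eval, h2, h3]
    · rw [(upd _ _ _).1, h4]
    · rw [(upd _ _ _).2 j hj, h5 j hj]

/-- Started with contents `ρ` of the main registers, the program halts within `t` operations, and
then the contents of the main registers satisfy `post`. -/
def Ensures (c : RealProgram (Register A B)) (ρ : Register A B → ℝ) (t : ℕ)
    (post : (Register A B → ℝ) → Prop) : Prop :=
  ∀ σ, σ ∘ Register.main = ρ → ∃ τ t', c.RunsIn σ τ t' ∧ t' ≤ t ∧ post (τ ∘ Register.main)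

/-- The assignment of the value of an expression to a main register. -/
def assign (r : Register A B) (e : RealExpr (Register A B)) : RealProgram (Register A B) :=
  .seq (e.compile 0) (.seq (.const (.scratch 1) 0) (.add r.main (.scratch 0) (.scratch 1)))

variable {c d : RealProgram (Register A B)} {ρ : Register A B → ℝ} {t u : ℕ}
  {post post' : (Register A B → ℝ) → Prop}

theorem Ensures.mono (h : Ensures c ρ t post) (htu : t ≤ u) (hpost : ∀ ρ, post ρ → post' ρ) :
    Ensures c ρ u post' := fun σ hσ => by
  obtain ⟨τ, t', h1, h2, h3⟩ := h σ hσ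
  exact ⟨τ, t', h1, h2.trans htu, hpost _ h3⟩

open Classical in
theorem Ensures.assign {r : Register A B} {e : RealExpr (Register A B)} (he : e.Defined ρ)
    (h : post (Function.update ρ r (e.eval ρ))) :
    Ensures (assign r e) ρ (e.cost + 2) post := fun σ hσ => by
  subst hσ
  obtain ⟨τ, h1, h2, h3, h4⟩ := e.compile_spec 0 σ he
  refine ⟨_, _, .seq _ _ _ _ _ _ _ h1 (.seq _ _ _ _ _ _ _ (.const _ _ _) (.add _ _ _ _)), le_rfl,
    ?_⟩
  convert h using 1
  funext r'
  have h01 : (Register.scratch 0 : Register A B) ≠ Register.scratch 1 :=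
    fun h => absurd (Register.scratch_inj.1 h) (by decide)
  by_cases hr : r' = r
  · subst hr
    simp [Function.update_of_ne h01, h2]
  · rw [Function.update_of_ne hr, Function.comp_apply,
      Function.update_of_ne (Register.main_injective.ne hr),
      Function.update_of_ne (Register.main_ne_scratch _ _), h3]
    rfl

theorem Ensures.seq (h : Ensures c ρ t fun ρ' => Ensures d ρ' u post) :
    Ensures (.seq c d) ρ (t + u) post := fun σ hσ => by
  obtain ⟨τ, t', h1, h2, h3⟩ := h σ hσ
  obtain ⟨υ, u', g1, g2, g3⟩ := h3 τ rfl
  exact ⟨υ, _, .seq _ _ _ _ _ _ _ h1 g1, by omega, g3⟩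

theorem Ensures.branch {x y : Register A B} (h1 : ρ x ≤ ρ y → Ensures c ρ t post)
    (h2 : ρ y < ρ x → Ensures d ρ t post) :
    Ensures (.branch x.main y.main c d) ρ (t + 1) post := fun σ hσ => by
  subst hσ
  rcases le_or_gt ((σ ∘ Register.main) x) ((σ ∘ Register.main) y) with h | h
  · obtain ⟨τ, t', g1, g2, g3⟩ := h1 h σ rfl
    exact ⟨τ, _, .branch_true _ _ _ _ _ _ _ h g1, by omega, g3⟩
  · obtain ⟨τ, t', g1, g2, g3⟩ := h2 h σ rfl
    exact ⟨τ, _, .branch_false _ _ _ _ _ _ _ (not_le.2 h) g1, by omega, g3⟩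

/-- The invariant counts iterations and forces exit once the count reaches `N`, so `N - k` serves as
termination measure. The postcondition keeps the exit count, on which the final accuracy depends. -/
theorem Ensures.loop {x y : Register A B} {I : ℕ → (Register A B → ℝ) → Prop} {N : ℕ}
    (hI : ∀ k ρ, I k ρ → ρ x ≤ ρ y → Ensures c ρ t (I (k + 1)))
    (hN : ∀ k ρ, I k ρ → N ≤ k → ρ y < ρ x) {k : ℕ} (hk : I k ρ) :
    Ensures (.loop x.main y.main c) ρ ((N - k) * (t + 1) + 1)
      fun ρ' => ∃ j, I j ρ' ∧ ρ' y < ρ' x := by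
  obtain ⟨m, hm⟩ : ∃ m, m = N - k := ⟨_, rfl⟩
  rw [← hm]
  induction m generalizing k ρ with
  | zero =>
    intro σ hσ
    subst hσ
    have h := hN k _ hk (by omega)
    exact ⟨σ, 1, .loop_false _ _ _ _ (not_le.2 h), by omega, k, hk, h⟩
  | succ m ih =>
    intro σ hσ
    subst hσ
    rcases le_or_gt ((σ ∘ Register.main) x) ((σ ∘ Register.main) y) with h | h
    · obtain ⟨τ, t', g1, g2, g3⟩ := hI k _ hk h σ rfl
      obtain ⟨υ, u', f1, f2, f3⟩ := ih g3 (by omega) τ rfl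
      refine ⟨υ, _, .loop_true _ _ _ _ _ _ _ _ h g1 f1, ?_, f3⟩
      rw [add_mul]
      omega
    · exact ⟨σ, 1, .loop_false _ _ _ _ (not_le.2 h), by omega, k, hk, h⟩

end Programs

/-! ### The program -/

section FrankWolfe

variable {A B : Type*} [Fintype A] [Fintype B]

/-- The part of the register contents that holds the current point of the simplex. -/
def outputs (ρ : Register A B → ℝ) : A → ℝ := fun x => ρ (.output x)

/-- The expression for the negative partial derivative of the objective. -/
noncomputable def descentExpr (x : A) : RealExpr (Register A B) :=
  .sum fun β : B => .div (.mul (.reg (.tally β)) (.reg (.protocol β x)))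
    (.sum fun x' : A => .mul (.reg (.protocol β x')) (.reg (.output x')))

/-- The step size `2 / (k + 2)`, where the main register `0` holds `k`. -/
def stepExpr : RealExpr (Register A B) := .div (.const 2) (.add (.reg (.work 0)) (.const 2))

open Classical in
/-- The new value of the coordinate `x` in the move towards the vertex `z`. -/
noncomputable def moveExpr (z x : A) : RealExpr (Register A B) :=
  .add (.mul (.sub (.const 1) stepExpr) (.reg (.output x)))
    (.mul stepExpr (.const (if x = z then 1 else 0)))

/-- The program that updates the coordinates in a list. -/
noncomputable def updateOutputs (e : A → RealExpr (Register A B)) :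
    List A → RealProgram (Register A B)
  -- There is no empty program; this writes to a temporary register whose value is no longer needed.
  | [] => assign (.work 2) (.const 0)
  | x :: l => .seq (updateOutputs e l) (assign (.output x) (e x))

/-- The program that determines which of the vertices in a list and `z` has the largest negative
partial derivative, and then runs the corresponding continuation. -/
noncomputable def selectVertex (cont : A → RealProgram (Register A B)) :
    List A → A → RealProgram (Register A B)
  | [], z => cont z
  | x :: l, z => .seq (assign (.work 2) (descentExpr z)) (.seq (assign (.work 3) (descentExpr x))
      (.branch (Register.work 2).main (Register.work 3).main
        (selectVertex cont l x) (selectVertex cont l z)))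

/-- The number of iterations, `32 r² / ε`. -/
noncomputable def iterationsExpr : RealExpr (Register A B) :=
  .div (.mul (.const 32) (.mul
      (.sum fun β : B => .sum fun x : A => .div (.const 1) (.reg (.protocol β x)))
      (.sum fun β : B => .sum fun x : A => .div (.const 1) (.reg (.protocol β x)))))
    (.reg .accuracy)

/-- One iteration of the Frank-Wolfe method. -/
noncomputable def iterationProgram (z : A) : RealProgram (Register A B) :=
  .seq (selectVertex (fun z => updateOutputs (moveExpr z) Finset.univ.toList) Finset.univ.toList z)
    (assign (.work 0) (.add (.reg (.work 0)) (.const 1)))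

/-- The Frank-Wolfe method, started at the vertex `z`. -/
noncomputable def frankWolfeProgram (z : A) : RealProgram (Register A B) :=
  .seq (assign (.output z) (.const 1)) (.seq (assign (.work 1) iterationsExpr)
    (.loop (Register.work 0).main (Register.work 1).main (iterationProgram z)))

/-- The cost of `selectVertex`, when `u` bounds the cost of the continuations and `v` that of the
evaluation of the partial derivatives. -/
def selectCost (u v : ℕ) : List A → ℕ
  | [] => u
  | _ :: l => (v + 2) + ((v + 2) + (selectCost u v l + 1))

theorem eval_descentExpr (ρ : Register A B → ℝ) (x : A) :
    (descentExpr x).eval ρ = ∑ β, ρ (.tally β) * ρ (.protocol β x) /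
      ∑ x', ρ (.protocol β x') * ρ (.output x') := by
  simp only [descentExpr, RealExpr.eval_sum, RealExpr.eval]

theorem defined_descentExpr {ρ : Register A B → ℝ} (x : A)
    (h : ∀ β, ∑ x', ρ (.protocol β x') * ρ (.output x') ≠ 0) : (descentExpr x).Defined ρ :=
  RealExpr.defined_sum fun β => ⟨⟨trivial, trivial⟩,
    RealExpr.defined_sum fun _ => ⟨trivial, trivial⟩, by
      simpa only [RealExpr.eval_sum, RealExpr.eval] using h β⟩

/-- The chosen vertex is not data in a register: each outcome of the comparisons has its own copy of
the continuation. Only the work registers `2` and `3` change, and the derivatives do not read them,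
so all comparisons refer to `ρ₀`. -/
theorem ensures_selectVertex {cont : A → RealProgram (Register A B)} {u v : ℕ}
    (hv : ∀ x : A, (descentExpr x : RealExpr (Register A B)).cost ≤ v)
    {ρ₀ : Register A B → ℝ} {post : (Register A B → ℝ) → Prop}
    (h0 : ∀ β, ∑ x', ρ₀ (.protocol β x') * ρ₀ (.output x') ≠ 0) (l : List A) (z : A)
    (hcont : ∀ z', (∀ x, x = z ∨ x ∈ l → (descentExpr x).eval ρ₀ ≤ (descentExpr z').eval ρ₀) →
      ∀ ρ, (∀ r, r ≠ .work 2 → r ≠ .work 3 → ρ r = ρ₀ r) → Ensures (cont z') ρ u post)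
    (ρ : Register A B → ℝ) (hρ : ∀ r, r ≠ .work 2 → r ≠ .work 3 → ρ r = ρ₀ r) :
    Ensures (selectVertex cont l z) ρ (selectCost u v l) post := by
  classical
  have hdef : ∀ ρ, (∀ r, r ≠ .work 2 → r ≠ .work 3 → ρ r = ρ₀ r) → ∀ x,
      (descentExpr x).Defined ρ ∧ (descentExpr x).eval ρ = (descentExpr x).eval ρ₀ := by
    intro ρ hρ x
    constructor
    · refine defined_descentExpr x fun β => ?_
      convert h0 β using 3 with x' <;> exact hρ _ (by simp) (by simp)
    · simp only [eval_descentExpr]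
      refine Finset.sum_congr rfl fun β _ => ?_
      rw [hρ (.tally β) (by simp) (by simp), hρ (.protocol β x) (by simp) (by simp)]
      congr 1
      refine Finset.sum_congr rfl fun x' _ => ?_
      rw [hρ (.output x') (by simp) (by simp), hρ (.protocol β x') (by simp) (by simp)]
  induction l generalizing z ρ with
  | nil =>
    refine hcont z (fun x hx => ?_) ρ hρ
    rcases hx with rfl | hx
    · exact le_rfl
    · simp at hx
  | cons x l ih =>
    set ρ₁ := Function.update ρ (.work 2) ((descentExpr z).eval ρ) with hρ₁
    have a₁ : ∀ r, r ≠ .work 2 → r ≠ .work 3 → ρ₁ r = ρ₀ r := fun r h2 h3 => by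
      rw [hρ₁, Function.update_of_ne h2, hρ r h2 h3]
    set ρ₂ := Function.update ρ₁ (.work 3) ((descentExpr x).eval ρ₁) with hρ₂
    have a₂ : ∀ r, r ≠ .work 2 → r ≠ .work 3 → ρ₂ r = ρ₀ r := fun r h2 h3 => by
      rw [hρ₂, Function.update_of_ne h3, a₁ r h2 h3]
    have e2 : ρ₂ (.work 2) = (descentExpr z).eval ρ₀ := by
      rw [hρ₂, Function.update_of_ne (by simp), hρ₁, Function.update_self, (hdef ρ hρ z).2]
    have e3 : ρ₂ (.work 3) = (descentExpr x).eval ρ₀ := by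
      rw [hρ₂, Function.update_self, (hdef ρ₁ a₁ x).2]
    refine Ensures.seq ((Ensures.assign (hdef ρ hρ z).1 ?_).mono
      (Nat.add_le_add_right (hv z) 2) fun _ => id)
    refine Ensures.seq ((Ensures.assign (hdef ρ₁ a₁ x).1 ?_).mono
      (Nat.add_le_add_right (hv x) 2) fun _ => id)
    refine Ensures.branch (fun h => ?_) (fun h => ?_)
    · change ρ₂ _ ≤ ρ₂ _ at h
      rw [e2, e3] at h
      refine ih x (fun z' hz' => hcont z' fun w hw => ?_) ρ₂ a₂
      rcases hw with rfl | hw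
      · exact h.trans (hz' x (Or.inl rfl))
      · exact hz' w (List.mem_cons.1 hw)
    · change ρ₂ _ < ρ₂ _ at h
      rw [e2, e3] at h
      refine ih z (fun z' hz' => hcont z' fun w hw => ?_) ρ₂ a₂
      rcases hw with rfl | hw
      · exact hz' w (Or.inl rfl)
      · rcases List.mem_cons.1 hw with rfl | hw
        · exact h.le.trans (hz' z (Or.inl rfl))
        · exact hz' w (Or.inr hw)

/-- The cost of `updateOutputs`. -/
def updateCost (e : A → RealExpr (Register A B)) : List A → ℕ
  | [] => 3
  | x :: l => updateCost e l + ((e x).cost + 2)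

-- Updating in place is sound because a new coordinate depends only on its own old value and the
-- counter; without duplicates in the list that old value is still present.
open Classical in
theorem ensures_updateOutputs {A B : Type*} {ρ : Register A B → ℝ} {k : ℕ} (hk : ρ (.work 0) = k) (z : A)
    {l : List A} (hl : l.Nodup) :
    Ensures (updateOutputs (moveExpr z) l) ρ (updateCost (B := B) (moveExpr z) l) fun ρ' =>
      (∀ r, r ≠ .work 2 → (∀ x, r ≠ .output x) → ρ' r = ρ r) ∧
      ∀ x, ρ' (.output x) =
        if x ∈ l then moveTowards (2 / ((k : ℝ) + 2)) (outputs ρ) z x else ρ (.output x) := by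
  induction l with
  | nil =>
    refine Ensures.assign trivial ⟨fun r h2 _ => Function.update_of_ne h2 _ _, fun x => ?_⟩
    rw [Function.update_of_ne (by simp)]
    simp
  | cons x l ih =>
    refine Ensures.seq ((ih hl.of_cons).mono le_rfl fun ρ' h => ?_)
    have h0 : ρ' (.work 0) = k := by rw [h.1 _ (by simp) (by simp), hk]
    have hx : ρ' (.output x) = ρ (.output x) := by rw [h.2, if_neg (List.nodup_cons.1 hl).1]
    have hk2 : (k : ℝ) + 2 ≠ 0 := by positivity
    have hs : stepExpr.Defined ρ' := by
      refine ⟨trivial, ⟨trivial, trivial⟩, ?_⟩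
      simpa [RealExpr.eval, h0] using hk2
    refine Ensures.assign ⟨⟨⟨trivial, hs⟩, trivial⟩, hs, trivial⟩ ⟨fun r h2 hr => ?_, fun x' => ?_⟩
    · rw [Function.update_of_ne (hr x), h.1 r h2 hr]
    · by_cases hxx : x' = x
      · subst hxx
        rw [Function.update_self, if_pos (by simp)]
        simp only [moveExpr, stepExpr, RealExpr.eval, h0, hx, moveTowards, outputs]
        split_ifs <;> simp
      · rw [Function.update_of_ne (by simpa using hxx), h.2]
        simp [hxx]

/-- The invariant of the main loop. -/
structure LoopInvariant (Q : PrivacyProtocol A B) (s : B → ℕ) (ε : ℝ) (k : ℕ)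
    (ρ : Register A B → ℝ) : Prop where
  protocol : ∀ β x, ρ (.protocol β x) = Q.mat β x
  tally : ∀ β, ρ (.tally β) = s β
  counter : ρ (.work 0) = k
  bound : ρ (.work 1) = 32 * Q.invSum ^ 2 / ε
  mem : outputs ρ ∈ stdSimplex ℝ A
  rate : 1 ≤ k → ∀ q ∈ stdSimplex ℝ A, objective Q s (outputs ρ) - objective Q s q ≤
    4 * (8 * Q.invSum ^ 2 * variation (stdSimplex ℝ A) (objective Q s)) / (k + 2)

/-- The bound `t` is read off the program text and so precedes `Q`, the tallies and `ε`. Sums over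
all vertices stand in for maxima of the costs. -/
theorem ensures_iterationProgram (z : A) :
    ∃ t, ∀ (Q : PrivacyProtocol A B), Q.IsRegular → ∀ (s : B → ℕ) (ε : ℝ) (k : ℕ)
      (ρ : Register A B → ℝ), LoopInvariant Q s ε k ρ →
      Ensures (iterationProgram z) ρ t (LoopInvariant Q s ε (k + 1)) := by
  classical
  refine ⟨selectCost (∑ z : A, updateCost (B := B) (moveExpr z) (Finset.univ : Finset A).toList)
    (∑ x : A, (descentExpr x : RealExpr (Register A B)).cost) (Finset.univ : Finset A).toList +
    (((RealExpr.reg (.work 0) : RealExpr (Register A B)).add (.const 1)).cost + 2),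
    fun Q hQ s ε k ρ hρ => ?_⟩
  have hdesc : ∀ x, (descentExpr x).eval ρ = descent Q (fun β => s β) (outputs ρ) x := by
    intro x
    simp only [eval_descentExpr, descent, hρ.protocol, hρ.tally, outputs]
  refine Ensures.seq (ensures_selectVertex
    (fun x => Finset.single_le_sum (f := fun x : A => (descentExpr x : RealExpr _).cost)
      (fun _ _ => Nat.zero_le _) (Finset.mem_univ x)) (ρ₀ := ρ) (fun β => ?_) _ _
    (fun z' hz' ρ₁ hρ₁ => ?_) ρ (fun _ _ _ => rfl))
  · simp only [hρ.protocol]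
    exact (hQ.mulVec_pos β hρ.mem).ne'
  have h0 : ρ₁ (.work 0) = k := by rw [hρ₁ _ (by simp) (by simp), hρ.counter]
  have hout : outputs ρ₁ = outputs ρ := funext fun x => hρ₁ _ (by simp) (by simp)
  have hz : ∀ x, descent Q (fun β => s β) (outputs ρ) x ≤
      descent Q (fun β => s β) (outputs ρ) z' := fun x => by
    rw [← hdesc, ← hdesc]
    exact hz' x (Or.inr (by simp))
  refine (ensures_updateOutputs h0 z' (Finset.nodup_toList _)).mono
    (Finset.single_le_sum (f := fun z : A => updateCost (B := B) (moveExpr z) _)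
      (fun _ _ => Nat.zero_le _) (Finset.mem_univ z')) fun ρ₂ h₂ => ?_
  have hk0 : (0 : ℝ) ≤ k := Nat.cast_nonneg k
  have hγ0 : 0 ≤ 2 / ((k : ℝ) + 2) := by positivity
  have hγ1 : 2 / ((k : ℝ) + 2) ≤ 1 := by
    rw [div_le_one (by positivity)]
    linarith
  have hout₂ : outputs ρ₂ = moveTowards (2 / ((k : ℝ) + 2)) (outputs ρ) z' := by
    funext x
    rw [outputs, h₂.2, if_pos (by simp), hout]
  have hold : ∀ r : Register A B, r ≠ .work 2 → r ≠ .work 3 → (∀ x, r ≠ .output x) →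
      ρ₂ r = ρ r := fun r h2 h3 hr => by rw [h₂.1 r h2 hr, hρ₁ r h2 h3]
  refine Ensures.assign ⟨trivial, trivial⟩ ?_
  have hout₃ : outputs (Function.update ρ₂ (.work 0) (((RealExpr.reg (.work 0)).add
      (.const 1)).eval ρ₂)) = moveTowards (2 / ((k : ℝ) + 2)) (outputs ρ) z' := by
    rw [← hout₂]
    funext x
    exact Function.update_of_ne (by simp) _ _
  refine ⟨fun β x => ?_, fun β => ?_, ?_, ?_, ?_, fun _ q hq => ?_⟩
  · rw [Function.update_of_ne (by simp), hold _ (by simp) (by simp) (by simp), hρ.protocol]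
  · rw [Function.update_of_ne (by simp), hold _ (by simp) (by simp) (by simp), hρ.tally]
  · rw [Function.update_self]
    simp [RealExpr.eval, hold _, hρ.counter]
  · rw [Function.update_of_ne (by simp), hold _ (by simp) (by simp) (by simp), hρ.bound]
  · rw [hout₃]
    exact moveTowards_mem hγ0 hγ1 hρ.mem z'
  · rw [hout₃]
    refine frankWolfe_rate ?_ (fun hk => hρ.rate hk q hq)
      (objective_moveTowards_le hQ s hρ.mem hq hz hγ0 hγ1)
    have := objective_sub_le_variation hQ s hq hq
    rw [sub_self] at this
    positivity

theorem LoopInvariant.isApproxMinimizer {Q : PrivacyProtocol A B} (hQ : Q.IsRegular) {s : B → ℕ}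
    {ε : ℝ} (hε : 0 < ε) {k : ℕ} {ρ : Register A B → ℝ} (h : LoopInvariant Q s ε k ρ)
    (hk : ρ (.work 1) < ρ (.work 0)) :
    IsApproxMinimizer ε (stdSimplex ℝ A) (objective Q s) (outputs ρ) := by
  refine ⟨h.mem, ?_⟩
  change _ ≤ ε * variation (stdSimplex ℝ A) (objective Q s)
  rw [h.counter, h.bound] at hk
  -- The iteration bound is nonnegative, so at exit at least one step has been made and the rate
  -- applies.
  have h1 : 1 ≤ k := by
    have : (0 : ℝ) < k := lt_of_le_of_lt (by positivity) hk
    exact_mod_cast this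
  rw [div_lt_iff₀ hε] at hk
  have hV : 0 ≤ variation (stdSimplex ℝ A) (objective Q s) := by
    have := objective_sub_le_variation hQ s h.mem h.mem
    rwa [sub_self] at this
  have h2 : 4 * (8 * Q.invSum ^ 2 * variation (stdSimplex ℝ A) (objective Q s)) / (k + 2) ≤
      ε * variation (stdSimplex ℝ A) (objective Q s) := by
    rw [div_le_iff₀ (by positivity)]
    nlinarith [mul_le_mul_of_nonneg_left hk.le hV, mul_nonneg hε.le hV]
  have h3 : objective Q s (outputs ρ) - ε * variation (stdSimplex ℝ A) (objective Q s) ≤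
      sInf (objective Q s '' stdSimplex ℝ A) := by
    refine le_csInf ⟨_, _, h.mem, rfl⟩ ?_
    rintro _ ⟨q, hq, rfl⟩
    linarith [h.rate h1 q hq]
  linarith

/-- The tallies come after `T`: the iteration count is limited by any natural number above `32 r² /
ε`, and the remaining costs are those of the program text. -/
theorem exists_program [Nonempty A] :
    ∃ prog : RealProgram (Register A B), ∀ Q : PrivacyProtocol A B, Q.IsRegular → ∀ ε : ℝ, 0 < ε →
      ∃ T : ℕ, ∀ s : B → ℕ, ∃ (final : Register A B → ℝ) (t : ℕ),
        prog.RunsIn (initialState Q s ε) final t ∧ t ≤ T ∧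
        IsApproxMinimizer ε (stdSimplex ℝ A) (objective Q s) (fun x => final (.output x)) := by
  classical
  obtain ⟨z⟩ := ‹Nonempty A›
  obtain ⟨t, ht⟩ := ensures_iterationProgram (B := B) z
  refine ⟨frankWolfeProgram z, fun Q hQ ε hε => ?_⟩
  obtain ⟨N, hN⟩ := exists_nat_gt (32 * Q.invSum ^ 2 / ε)
  refine ⟨((RealExpr.const 1 : RealExpr (Register A B)).cost + 2) +
    (((iterationsExpr : RealExpr (Register A B)).cost + 2) + ((N - 0) * (t + 1) + 1)),
    fun s => ?_⟩
  have main : Ensures (frankWolfeProgram z) (initialState Q s ε)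
      (((RealExpr.const 1 : RealExpr (Register A B)).cost + 2) +
        (((iterationsExpr : RealExpr (Register A B)).cost + 2) + ((N - 0) * (t + 1) + 1)))
      fun ρ => ∃ k, LoopInvariant Q s ε k ρ ∧ ρ (.work 1) < ρ (.work 0) := by
    refine Ensures.seq (Ensures.assign trivial ?_)
    refine Ensures.seq (Ensures.assign ?_ ?_)
    · have hd : ∀ (ρ : Register A B → ℝ), (∀ β x, ρ (.protocol β x) ≠ 0) →
          (RealExpr.sum fun β : B => .sum fun x : A =>
            .div (.const 1) (.reg (.protocol β x))).Defined ρ := fun ρ h =>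
        RealExpr.defined_sum fun β => RealExpr.defined_sum fun x => ⟨trivial, trivial, h β x⟩
      refine ⟨⟨trivial, hd _ fun β x => ?_, hd _ fun β x => ?_⟩, trivial, ?_⟩
      · simpa [initialState] using (hQ.mat_pos β x).ne'
      · simpa [initialState] using (hQ.mat_pos β x).ne'
      · simpa [RealExpr.eval, initialState] using hε.ne'
    · refine Ensures.loop (fun k ρ h _ => ht Q hQ s ε k ρ h) (fun k ρ h hk => ?_) (k := 0) ?_
      · rw [h.bound, h.counter]
        exact hN.trans_le (by exact_mod_cast hk)
      · have hout : outputs (Function.update (Function.update (initialState Q s ε) (.output z)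
            ((RealExpr.const 1).eval (initialState Q s ε))) (.work 1) (iterationsExpr.eval
            (Function.update (initialState Q s ε) (.output z)
            ((RealExpr.const 1).eval (initialState Q s ε))))) = Pi.single z 1 := by
          funext x
          by_cases hx : x = z
          · subst hx
            simp [outputs, RealExpr.eval]
          · simp [outputs, hx, initialState]
        refine ⟨by simp [initialState], by simp [initialState], by simp [initialState], ?_, ?_,
          fun h => absurd h (by simp)⟩
        · simp [iterationsExpr, RealExpr.eval, RealExpr.eval_sum, initialState,
            PrivacyProtocol.invSum, sq]
        · rw [hout]
          exact single_mem_stdSimplex ℝ z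
  -- All work registers start at zero, so their renumbering is invisible here.
  have hinit : initialState Q s ε ∘ Register.main = initialState Q s ε := by
    funext r
    cases r <;> rfl
  obtain ⟨τ, t', h1, h2, k, h3, h4⟩ := main _ hinit
  exact ⟨τ, t', h1, h2, h3.isApproxMinimizer hQ hε h4⟩

end FrankWolfe

end LDP

namespace LDP

/-! ### The likelihood -/

section Likelihood

variable {A B : Type*} [Fintype A] [Fintype B] [MeasurableSpace A] [MeasurableSingletonClass A]
  [MeasurableSpace B] [MeasurableSingletonClass B] {Q : PrivacyProtocol A B}

theorem measurable_perturbed {A B : Type*} [MeasurableSpace A] [MeasurableSpace B] (n : ℕ) :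
    Measurable (perturbed n : (ℕ → A × B) → Fin n → B) :=
  measurable_pi_lambda _ fun _ => measurable_snd.comp (measurable_pi_apply _)

theorem measurableSet_perturbed_eq {A B : Type*} [MeasurableSpace A] [MeasurableSpace B]
    [MeasurableSingletonClass B] {n : ℕ} (y : Fin n → B) :
    MeasurableSet {w : ℕ → A × B | perturbed n w = y} :=
  measurable_perturbed n (measurableSet_singleton y)

theorem userLaw_snd_eq (Q : PrivacyProtocol A B) (p : stdSimplex ℝ A) (b : B) :
    userLaw Q p {q | q.2 = b} = ENNReal.ofReal (Q.mat.mulVec p.1 b) := by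
  classical
  simp only [userLaw, Measure.coe_finsetSum, Finset.sum_apply, Measure.smul_apply, smul_eq_mul,
    Measure.dirac_apply, Set.indicator_apply, Set.mem_ofPred_eq, Pi.one_apply, mul_ite, mul_one,
    mul_zero, Finset.sum_ite_eq', Finset.mem_univ, if_true, Matrix.mulVec, dotProduct]
  rw [ENNReal.ofReal_sum_of_nonneg fun x _ => mul_nonneg (Q.mat_nonneg b x) (p.2.1 x)]
  simp only [mul_comm]

theorem likelihood_eq_prod (hQ : Q.IsRegular) {n : ℕ} (y : Fin n → B) (p : stdSimplex ℝ A) :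
    likelihood Q y p = ∏ i, Q.mat.mulVec p.1 (y i) := by
  -- The event as a cylinder over `ℕ`; the condition is vacuous for `i ≥ n`, which makes the sets
  -- meaningful for every index.
  have h : {w : ℕ → A × B | perturbed n w = y} = Set.pi (Finset.range n : Set ℕ)
      fun i => {q | ∀ h : i < n, q.2 = y ⟨i, h⟩} := by
    ext w
    simp only [perturbed, Set.mem_ofPred_eq, funext_iff, Set.mem_pi, Finset.coe_range, Set.mem_Iio]
    exact ⟨fun H i _ h => H ⟨i, h⟩, fun H i => H i.1 i.2 i.2⟩
  have hm : ∀ i ∈ Finset.range n, MeasurableSet {q : A × B | ∀ h : i < n, q.2 = y ⟨i, h⟩} :=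
    fun i _ => Set.Finite.measurableSet (Set.toFinite _)
  rw [likelihood, Measure.real, h]
  change (Measure.infinitePi _ _).toReal = _
  rw [Measure.infinitePi_pi _ hm, Finset.prod_range, ENNReal.toReal_prod]
  refine Finset.prod_congr rfl fun i _ => ?_
  have : {q : A × B | ∀ h : i.1 < n, q.2 = y ⟨i.1, h⟩} = {q | q.2 = y i} := by
    ext q
    exact ⟨fun H => H i.2, fun H _ => H⟩
  rw [this, userLaw_snd_eq, ENNReal.toReal_ofReal (hQ.mulVec_pos _ p.2).le]

theorem likelihood_eq_exp (hQ : Q.IsRegular) {n : ℕ} (y : Fin n → B) (p : stdSimplex ℝ A) :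
    likelihood Q y p = Real.exp (-objective Q (tally y) p.1) := by
  classical
  rw [likelihood_eq_prod hQ, objective, neg_neg, Real.exp_sum,
    ← Finset.prod_fiberwise' Finset.univ y fun b => Q.mat.mulVec p.1 b]
  refine Finset.prod_congr rfl fun b _ => ?_
  rw [Finset.prod_const, Real.exp_nat_mul, Real.exp_log (hQ.mulVec_pos b p.2), tally]

theorem likelihood_pos (hQ : Q.IsRegular) {n : ℕ} (y : Fin n → B) (p : stdSimplex ℝ A) :
    0 < likelihood Q y p := by
  rw [likelihood_eq_exp hQ]
  exact Real.exp_pos _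

theorem isMLE_iff_isMinOn (hQ : Q.IsRegular) {n : ℕ} (y : Fin n → B) (p : stdSimplex ℝ A) :
    IsMLE Q y p ↔ IsMinOn (objective Q (tally y)) (stdSimplex ℝ A) (p : A → ℝ) := by
  simp only [IsMLE, likelihood_eq_exp hQ, Real.exp_le_exp, neg_le_neg_iff, isMinOn_iff,
    Subtype.forall]
  rfl

theorem exists_isMLE [Nonempty A] (hQ : Q.IsRegular) {n : ℕ} (y : Fin n → B) :
    ∃ p, IsMLE Q y p := by
  classical
  obtain ⟨p, hp, h⟩ := (isCompact_stdSimplex ℝ A).exists_isMinOn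
    ⟨_, single_mem_stdSimplex ℝ (Classical.arbitrary A)⟩ (hQ.continuousOn_objective (tally y))
  exact ⟨⟨p, hp⟩, (isMLE_iff_isMinOn hQ y _).2 h⟩

theorem continuous_likelihood (hQ : Q.IsRegular) {n : ℕ} (y : Fin n → B) :
    Continuous (likelihood Q y) := by
  simp only [funext (likelihood_eq_exp hQ y)]
  exact Real.continuous_exp.comp
    (continuousOn_iff_continuous_domRestrict.1 (hQ.continuousOn_objective (tally y))).neg

theorem finrank_vectorSpan_stdSimplex (A : Type*) [Fintype A] [Nonempty A] :
    Module.finrank ℝ (vectorSpan ℝ (stdSimplex ℝ A)) = Fintype.card A - 1 := by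
  classical
  rw [← convexHull_rangle_single_eq_stdSimplex, ← direction_affineSpan, affineSpan_convexHull,
    direction_affineSpan]
  refine AffineIndependent.finrank_vectorSpan
    (Pi.linearIndependent_single_one A ℝ).affineIndependent ?_
  have := Fintype.card_pos (α := A)
  omega

end Likelihood

/-! ### Optimal estimators -/

section Optimal

variable {A B : Type*} [Fintype A] [Fintype B] [MeasurableSpace A]
  [MeasurableSpace B] [MeasurableSingletonClass B]
  {Q : PrivacyProtocol A B} {μ : Measure (stdSimplex ℝ A)} [IsProbabilityMeasure μ]

instance jointLaw_isProbabilityMeasure {A B : Type*} [Fintype A] [Fintype B] [MeasurableSpace A]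
    [MeasurableSpace B] (Q : PrivacyProtocol A B) (μ : Measure (stdSimplex ℝ A))
    [IsProbabilityMeasure μ] : IsProbabilityMeasure (jointLaw Q μ) :=
  inferInstanceAs (IsProbabilityMeasure (μ ⊗ₘ dataKernel Q))

theorem integrable_of_continuous {A : Type*} [Fintype A]
    {μ : Measure (stdSimplex ℝ A)} [IsProbabilityMeasure μ] {g : stdSimplex ℝ A → ℝ} (hg : Continuous g) :
    Integrable g μ := by
  obtain ⟨C, hC⟩ := isCompact_univ.exists_bound_of_continuousOn hg.continuousOn
  exact Integrable.of_bound hg.measurable.aestronglyMeasurable C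
      (ae_of_all _ fun ω => hC _ (Set.mem_univ _))

/-- The event that the perturbed data of the first `n` users are `y`. -/
def dataEvent {A B : Type*} [Fintype A] {n : ℕ} (y : Fin n → B) :
    Set (stdSimplex ℝ A × (ℕ → A × B)) := {ω | perturbed n ω.2 = y}

theorem measurableSet_dataEvent {A B : Type*} [Fintype A] [MeasurableSpace A]
    [MeasurableSpace B] [MeasurableSingletonClass B] {n : ℕ} (y : Fin n → B) :
    MeasurableSet (dataEvent (A := A) y) :=
  measurable_snd (measurableSet_perturbed_eq y)

/-- Disintegration: integrating out the data at fixed `p` leaves the likelihood as a density with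
respect to the prior. -/
theorem setIntegral_dataEvent {n : ℕ} (y : Fin n → B) {g : stdSimplex ℝ A → ℝ}
    (hg : Continuous g) :
    ∫ ω in dataEvent y, g ω.1 ∂(jointLaw Q μ) = ∫ p, likelihood Q y p * g p ∂μ := by
  have h : dataEvent (A := A) y = Set.univ ×ˢ {w | perturbed n w = y} := by
    ext ω
    simp [dataEvent]
  obtain ⟨C, hC⟩ := isCompact_univ.exists_bound_of_continuousOn hg.continuousOn
  have hi : Integrable (fun ω : stdSimplex ℝ A × (ℕ → A × B) => g ω.1) (jointLaw Q μ) :=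
    Integrable.of_bound (hg.measurable.comp measurable_fst).aestronglyMeasurable C
      (ae_of_all _ fun ω => hC _ (Set.mem_univ _))
  rw [h, jointLaw, Measure.setIntegral_compProd MeasurableSet.univ (measurableSet_perturbed_eq y)
    hi.integrableOn]
  simp only [setIntegral_const, smul_eq_mul, Measure.restrict_univ]
  rfl

theorem measureReal_dataEvent {n : ℕ} (y : Fin n → B) :
    (jointLaw Q μ).real (dataEvent y) = ∫ p, likelihood Q y p ∂μ := by
  have := setIntegral_dataEvent (Q := Q) (μ := μ) y (g := fun _ => 1) continuous_const
  simpa using this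

theorem continuous_coord {A : Type*} [Fintype A] (x : A) :
    Continuous fun p : stdSimplex ℝ A => p.1 x :=
  (continuous_apply x).comp continuous_subtype_val

theorem posteriorMean_eq (n : ℕ) (y : Fin n → B) (x : A) :
    posteriorMean Q μ n y x =
      (∫ p, likelihood Q y p * p.1 x ∂μ) / ∫ p, likelihood Q y p ∂μ := by
  rw [← measureReal_dataEvent, ← setIntegral_dataEvent y (continuous_coord x), posteriorMean,
    ProbabilityTheory.cond, integral_smul_measure, ENNReal.toReal_inv, smul_eq_mul,
    inv_mul_eq_div]
  rfl

theorem mse_eq_sum (n : ℕ) (est : (Fin n → B) → A → ℝ) :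
    mse Q μ n est = ∑ y, ∑ x, ∫ ω in dataEvent y, (ω.1.1 x - est y x) ^ 2 ∂(jointLaw Q μ) := by
  classical
  have hcont : ∀ (y : Fin n → B) (x : A),
      Continuous fun p : stdSimplex ℝ A => (p.1 x - est y x) ^ 2 := fun y x =>
    ((continuous_coord x).sub continuous_const).pow 2
  have hi : ∀ (y : Fin n → B) (x : A), Integrable
      (fun ω : stdSimplex ℝ A × (ℕ → A × B) => (ω.1.1 x - est y x) ^ 2) (jointLaw Q μ) := by
    intro y x
    obtain ⟨C, hC⟩ := isCompact_univ.exists_bound_of_continuousOn (hcont y x).continuousOn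
    exact Integrable.of_bound ((hcont y x).measurable.comp measurable_fst).aestronglyMeasurable C
      (ae_of_all _ fun ω => hC _ (Set.mem_univ _))
  have hsplit : ∀ ω : stdSimplex ℝ A × (ℕ → A × B),
      ∑ x, (ω.1.1 x - est (perturbed n ω.2) x) ^ 2 =
      ∑ y, (dataEvent y).indicator (fun ω => ∑ x, (ω.1.1 x - est y x) ^ 2) ω := by
    intro ω
    symm
    rw [Finset.sum_eq_single (perturbed n ω.2)]
    · exact Set.indicator_of_mem (s := dataEvent (perturbed n ω.2)) rfl
        fun ω' : stdSimplex ℝ A × (ℕ → A × B) => ∑ x, (ω'.1.1 x - est (perturbed n ω.2) x) ^ 2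
    · exact fun y _ hy => Set.indicator_of_notMem (s := dataEvent y)
        (fun h : perturbed n ω.2 = y => hy h.symm) _
    · exact fun h => absurd (Finset.mem_univ _) h
  have hiy : ∀ y, Integrable (fun ω : stdSimplex ℝ A × (ℕ → A × B) =>
      ∑ x, (ω.1.1 x - est y x) ^ 2) (jointLaw Q μ) := fun y =>
    integrable_finsetSum _ fun x _ => hi y x
  rw [mse]
  simp only [hsplit]
  rw [integral_finsetSum _ fun y _ => (hiy y).indicator (measurableSet_dataEvent y)]
  refine Finset.sum_congr rfl fun y _ => ?_
  rw [integral_indicator (measurableSet_dataEvent y),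
    integral_finsetSum _ fun x _ => (hi y x).integrableOn]

variable [MeasurableSingletonClass A]

theorem measureReal_dataEvent_pos (hQ : Q.IsRegular) {n : ℕ} (y : Fin n → B) :
    0 < (jointLaw Q μ).real (dataEvent y) := by
  rw [measureReal_dataEvent, integral_pos_iff_support_of_nonneg
    (fun p => (likelihood_pos hQ y p).le) (integrable_of_continuous (continuous_likelihood hQ y))]
  have : Function.support (likelihood Q y) = Set.univ :=
    Set.eq_univ_of_forall fun p => (likelihood_pos hQ y p).ne'
  rw [this, measure_univ]
  exact one_pos

/-- As a function of `c` the left side is a quadratic polynomial with leading coefficient `ℙ(Y = y)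
> 0` and vertex at the posterior mean. -/
theorem setIntegral_sq_sub_eq (hQ : Q.IsRegular) {n : ℕ} (y : Fin n → B) (x : A) (c : ℝ) :
    ∫ ω in dataEvent y, (ω.1.1 x - c) ^ 2 ∂(jointLaw Q μ) =
      ∫ ω in dataEvent y, (ω.1.1 x - posteriorMean Q μ n y x) ^ 2 ∂(jointLaw Q μ) +
        (jointLaw Q μ).real (dataEvent y) * (c - posteriorMean Q μ n y x) ^ 2 := by
  have hc := continuous_coord x
  have hl := continuous_likelihood hQ y
  have e : ∀ c : ℝ, ∫ ω in dataEvent y, (ω.1.1 x - c) ^ 2 ∂(jointLaw Q μ) =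
      (∫ p, likelihood Q y p * p.1 x ^ 2 ∂μ) - 2 * c * (∫ p, likelihood Q y p * p.1 x ∂μ) +
        c ^ 2 * ∫ p, likelihood Q y p ∂μ := by
    intro c
    rw [setIntegral_dataEvent (g := fun p => (p.1 x - c) ^ 2) y
        ((hc.sub continuous_const).pow 2),
      ← integral_const_mul, ← integral_const_mul, ← integral_sub, ← integral_add]
    · congr 1
      funext p
      ring
    · exact integrable_of_continuous
        ((hl.mul (hc.pow 2)).sub (continuous_const.mul (hl.mul hc)))
    · exact integrable_of_continuous (continuous_const.mul hl)
    · exact integrable_of_continuous (hl.mul (hc.pow 2))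
    · exact integrable_of_continuous (continuous_const.mul (hl.mul hc))
  have h := measureReal_dataEvent_pos (μ := μ) hQ y
  rw [measureReal_dataEvent] at h
  rw [e, e, measureReal_dataEvent, posteriorMean_eq]
  field_simp
  ring

theorem mse_eq_add (hQ : Q.IsRegular) (n : ℕ) (est : (Fin n → B) → A → ℝ) :
    mse Q μ n est = mse Q μ n (posteriorMean Q μ n) + ∑ y, ∑ x,
      (jointLaw Q μ).real (dataEvent y) * (est y x - posteriorMean Q μ n y x) ^ 2 := by
  simp only [mse_eq_sum, ← Finset.sum_add_distrib]
  exact Finset.sum_congr rfl fun y _ => Finset.sum_congr rfl fun x _ =>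
    setIntegral_sq_sub_eq hQ y x _

theorem isOptimalEstimator_iff (hQ : Q.IsRegular) (n : ℕ) (est : (Fin n → B) → A → ℝ) :
    IsOptimalEstimator Q μ n est ↔ est = posteriorMean Q μ n := by
  have h0 : ∀ (est : (Fin n → B) → A → ℝ) y x,
      0 ≤ (jointLaw Q μ).real (dataEvent y) * (est y x - posteriorMean Q μ n y x) ^ 2 :=
    fun est y x => by positivity
  constructor
  · intro h
    have h1 := h (posteriorMean Q μ n)
    rw [mse_eq_add hQ n est, add_le_iff_nonpos_right] at h1
    have h2 := le_antisymm h1 (Finset.sum_nonneg fun y _ => Finset.sum_nonneg fun x _ => h0 est y x)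
    rw [Finset.sum_eq_zero_iff_of_nonneg
      fun y _ => Finset.sum_nonneg fun x _ => h0 est y x] at h2
    funext y x
    have h3 := (Finset.sum_eq_zero_iff_of_nonneg fun x _ => h0 est y x).1
      (h2 y (Finset.mem_univ _)) x (Finset.mem_univ _)
    rcases mul_eq_zero.1 h3 with h4 | h4
    · exact absurd h4 (measureReal_dataEvent_pos hQ y).ne'
    · exact sub_eq_zero.1 (pow_eq_zero_iff two_ne_zero |>.1 h4)
  · rintro rfl est'
    rw [mse_eq_add hQ n est']
    exact le_add_of_nonneg_right
      (Finset.sum_nonneg fun y _ => Finset.sum_nonneg fun x _ => h0 est' y x)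

end Optimal

end LDP

namespace LDP

/-! ### Laplace's method on compact spaces -/

section Laplace

variable {X : Type*} [TopologicalSpace X] [CompactSpace X]

theorem exists_gap {φ : X → ℝ} (hφ : Continuous φ) {x₀ : X} (hmin : ∀ x, x ≠ x₀ → φ x₀ < φ x)
    {U : Set X} (hU : IsOpen U) (hx₀ : x₀ ∈ U) : ∃ c > 0, ∀ x ∉ U, φ x₀ + c ≤ φ x := by
  rcases Uᶜ.eq_empty_or_nonempty with h | h
  · exact ⟨1, one_pos, fun x hx => absurd (h ▸ hx : x ∈ (∅ : Set X)) (Set.notMem_empty x)⟩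
  · obtain ⟨z, hz, hz'⟩ := hU.isClosed_compl.isCompact.exists_isMinOn h hφ.continuousOn
    have hz0 : z ≠ x₀ := fun h => hz (h ▸ hx₀)
    refine ⟨φ z - φ x₀, sub_pos.2 (hmin z hz0), fun x hx => ?_⟩
    rw [add_sub_cancel]
    exact hz' hx

/-- Approximate minimisers of functions that converge uniformly to a function with a unique
minimiser converge to this minimiser. -/
theorem tendsto_of_minimizes {φ : X → ℝ} (hφ : Continuous φ) {f : ℕ → X → ℝ}
    (hf : TendstoUniformly f φ atTop) {x₀ : X} (hmin : ∀ x, x ≠ x₀ → φ x₀ < φ x) {x : ℕ → X}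
    (hx : ∀ᶠ n in atTop, f n (x n) ≤ f n x₀) : Tendsto x atTop (𝓝 x₀) := by
  refine tendsto_nhds.2 fun U hU hx₀ => ?_
  obtain ⟨c, hc, hgap⟩ := exists_gap hφ hmin hU hx₀
  -- With uniform error below `c / 2`, a point outside `U` would have `f n` strictly above its value
  -- at `x₀`.
  filter_upwards [hx, Metric.tendstoUniformly_iff.1 hf (c / 2) (half_pos hc)] with n h1 h2
  by_contra h3
  have h4 := hgap _ h3
  have h5 := abs_lt.1 (h2 (x n))
  have h6 := abs_lt.1 (h2 x₀)
  linarith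

variable [MeasurableSpace X] [BorelSpace X] {μ : Measure X} [IsProbabilityMeasure μ]

/-- The Gibbs measures with energies `n f n` concentrate at the unique minimiser of the uniform
limit of the `f n`, if it lies in the support of the reference measure. -/
theorem tendsto_gibbs_integral {φ : X → ℝ} (hφ : Continuous φ) {f : ℕ → X → ℝ}
    (hfc : ∀ n, Continuous (f n)) (hf : TendstoUniformly f φ atTop) {x₀ : X}
    (hmin : ∀ x, x ≠ x₀ → φ x₀ < φ x) (hx₀ : x₀ ∈ μ.support) {g : X → ℝ} (hg : Continuous g) :
    Tendsto (fun n : ℕ => (∫ x, Real.exp (-(n * f n x)) * g x ∂μ) /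
      ∫ x, Real.exp (-(n * f n x)) ∂μ) atTop (𝓝 (g x₀)) := by
  have hint : ∀ {h : X → ℝ}, Continuous h → Integrable h μ := fun {h} hh => by
    obtain ⟨C, hC⟩ := isCompact_univ.exists_bound_of_continuousOn hh.continuousOn
    exact Integrable.of_bound hh.measurable.aestronglyMeasurable C
      (ae_of_all _ fun ω => hC _ (Set.mem_univ _))
  have hec : ∀ n : ℕ, Continuous fun x => Real.exp (-(n * f n x)) := fun n =>
    Real.continuous_exp.comp (continuous_const.mul (hfc n)).neg
  set Z : ℕ → ℝ := fun n => ∫ x, Real.exp (-(n * f n x)) ∂μ with hZ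
  have hZpos : ∀ n, 0 < Z n := fun n => integral_exp_pos (hint (hec n))
  have key : Tendsto (fun n : ℕ => ∫ x in Set.univ, (Real.exp (-(n * f n x)) / Z n) • g x ∂μ) atTop
      (𝓝 (g x₀)) := by
    -- The normalised Gibbs densities form an approximate identity at `x₀`; what needs work is their
    -- uniform decay outside neighbourhoods of `x₀`.
    refine tendsto_setIntegral_peak_smul_of_integrableOn_of_tendsto (x₀ := x₀) MeasurableSet.univ
      MeasurableSet.univ subset_rfl univ_mem (measure_ne_top _ _)
      (Eventually.of_forall fun n x _ => div_nonneg (Real.exp_pos _).le (hZpos n).le)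
      (fun U hU hxU => ?_) ?_ (Eventually.of_forall fun n => ?_) ?_ ?_
    · obtain ⟨c, hc, hgap⟩ := exists_gap hφ hmin hU hxU
      -- With uniform error `c / 4`, the energy is at least `φ x₀ + 3c/4` outside `U` and at most `φ
      -- x₀ + c/2` on `V`. Since `V` has positive mass, the density outside `U` is at most `exp(-n c
      -- / 4) / μ(V)`.
      set V : Set X := {x | φ x < φ x₀ + c / 4} with hV
      have hVo : IsOpen V := isOpen_lt hφ continuous_const
      have hVpos : 0 < μ.real V := by
        refine ENNReal.toReal_pos (((Measure.mem_support_iff_forall x₀).1 hx₀ V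
          (hVo.mem_nhds ?_)).ne') (measure_ne_top _ _)
        change φ x₀ < φ x₀ + c / 4
        linarith
      have hlim : Tendsto (fun n : ℕ => Real.exp (-(n * (c / 4))) / μ.real V) atTop (𝓝 0) := by
        have h1 : Tendsto (fun n : ℕ => (n : ℝ) * (c / 4)) atTop atTop :=
          tendsto_natCast_atTop_atTop.atTop_mul_const (by positivity)
        have h2 := (Real.tendsto_exp_neg_atTop_nhds_zero.comp h1).div_const (μ.real V)
        rwa [zero_div] at h2
      rw [Metric.tendstoUniformlyOn_iff]
      intro δ hδ
      filter_upwards [hlim.eventually (gt_mem_nhds hδ),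
        Metric.tendstoUniformly_iff.1 hf (c / 4) (by positivity)] with n h1 h2 x hx
      have hn : (0 : ℝ) ≤ n := Nat.cast_nonneg n
      have hnum : Real.exp (-(n * f n x)) ≤ Real.exp (-(n * (φ x₀ + c / 2 + c / 4))) := by
        refine Real.exp_le_exp.2 (neg_le_neg (mul_le_mul_of_nonneg_left ?_ hn))
        have := abs_lt.1 (h2 x)
        have := hgap x hx.2
        linarith
      have hden : μ.real V * Real.exp (-(n * (φ x₀ + c / 2))) ≤ Z n := by
        calc μ.real V * Real.exp (-(n * (φ x₀ + c / 2)))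
            = ∫ x in V, Real.exp (-(n * (φ x₀ + c / 2))) ∂μ := by
              rw [setIntegral_const, smul_eq_mul]
          _ ≤ ∫ x in V, Real.exp (-(n * f n x)) ∂μ := by
              refine setIntegral_mono_on (integrable_const _).integrableOn
                (hint (hec n)).integrableOn hVo.measurableSet fun x hx => ?_
              refine Real.exp_le_exp.2 (neg_le_neg (mul_le_mul_of_nonneg_left ?_ hn))
              have := abs_lt.1 (h2 x)
              have : φ x < φ x₀ + c / 4 := hx
              linarith
          _ ≤ Z n := setIntegral_le_integral (hint (hec n))
              (ae_of_all _ fun x => (Real.exp_pos _).le)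
      rw [Pi.zero_apply, dist_zero_left, Real.norm_of_nonneg
        (div_nonneg (Real.exp_pos _).le (hZpos n).le)]
      refine lt_of_le_of_lt ?_ h1
      rw [div_le_div_iff₀ (hZpos n) hVpos]
      calc Real.exp (-(n * f n x)) * μ.real V
          ≤ Real.exp (-(n * (φ x₀ + c / 2 + c / 4))) * μ.real V :=
            mul_le_mul_of_nonneg_right hnum hVpos.le
        _ = Real.exp (-(n * (c / 4))) * (μ.real V * Real.exp (-(n * (φ x₀ + c / 2)))) := by
            rw [mul_left_comm, ← Real.exp_add, mul_comm]
            congr 2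
            ring
        _ ≤ _ := mul_le_mul_of_nonneg_left hden (Real.exp_pos _).le
    · have : ∀ n : ℕ, ∫ x in Set.univ, Real.exp (-(n * f n x)) / Z n ∂μ = 1 := fun n => by
        rw [Measure.restrict_univ, integral_div, div_self (hZpos n).ne']
      simp only [this]
      exact tendsto_const_nhds
    · exact ((hec n).div_const _).measurable.aestronglyMeasurable
    · exact (hint hg).integrableOn
    · exact hg.continuousAt.continuousWithinAt
  refine key.congr fun n => ?_
  rw [Measure.restrict_univ, ← integral_div]
  congr 1
  funext x
  rw [smul_eq_mul]
  ring

end Laplace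

/-! ### Consistency -/

section Consistency

variable {A B : Type*} [Fintype A] [Fintype B] {Q : PrivacyProtocol A B}

/-- The cross entropy of a distribution `q` of the perturbed data relative to the distribution that
belongs to the distribution `p` of the private data. -/
noncomputable def crossEntropy (Q : PrivacyProtocol A B) (q : B → ℝ) (p : stdSimplex ℝ A) : ℝ :=
  -∑ β, q β * Real.log (Q.mat.mulVec p.1 β)

theorem continuous_crossEntropy (hQ : Q.IsRegular) (q : B → ℝ) :
    Continuous (crossEntropy Q q) :=
  (continuous_finsetSum _ fun β _ => continuous_const.mul
    (continuousOn_iff_continuous_domRestrict.1 (hQ.continuousOn_log_mulVec β))).neg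

/-- The bound that makes convergence of the frequencies uniform in `p`; it follows from `log t ≤ t`
at `t = 1 / (Q p)_β`. -/
theorem abs_log_mulVec_le (hQ : Q.IsRegular) (β : B) (p : stdSimplex ℝ A) :
    |Real.log (Q.mat.mulVec p.1 β)| ≤ Q.invSum := by
  have hp := hQ.mulVec_pos β p.2
  rw [abs_of_nonpos (Real.log_nonpos hp.le (Q.mulVec_le_one β p.2)), ← Real.log_inv]
  refine (Real.log_le_self (inv_nonneg.2 hp.le)).trans ?_
  rw [inv_le_iff_one_le_mul₀ hp]
  exact hQ.one_le_invSum_mul_mulVec β p.2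

theorem tendstoUniformly_crossEntropy (hQ : Q.IsRegular) {q : ℕ → B → ℝ} {q₀ : B → ℝ}
    (hq : ∀ β, Tendsto (fun n => q n β) atTop (𝓝 (q₀ β))) :
    TendstoUniformly (fun n => crossEntropy Q (q n)) (crossEntropy Q q₀) atTop := by
  rw [Metric.tendstoUniformly_iff]
  intro δ hδ
  have hlim : Tendsto (fun n => ∑ β, |q n β - q₀ β| * Q.invSum) atTop (𝓝 0) := by
    have : (0 : ℝ) = ∑ β, |q₀ β - q₀ β| * Q.invSum := by simp
    rw [this]
    exact tendsto_finsetSum _ fun β _ => ((hq β).sub_const _).abs.mul_const _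
  filter_upwards [hlim.eventually (gt_mem_nhds hδ)] with n hn p
  refine lt_of_le_of_lt ?_ hn
  rw [Real.dist_eq, crossEntropy, crossEntropy, neg_sub_neg, ← Finset.sum_sub_distrib]
  refine (Finset.abs_sum_le_sum_abs _ _).trans (Finset.sum_le_sum fun β _ => ?_)
  rw [← sub_mul, abs_mul]
  exact mul_le_mul_of_nonneg_left (abs_log_mulVec_le hQ β p) (abs_nonneg _)

/-- Gibbs' inequality. It is strict because injectivity of `Q` yields an output where `Q p` and `Q
p₀` differ, and `log t < t - 1` for `t ≠ 1`. -/
theorem crossEntropy_lt (hQ : Q.IsRegular) {p₀ p : stdSimplex ℝ A} (hp : p ≠ p₀) :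
    crossEntropy Q (Q.mat.mulVec p₀.1) p₀ < crossEntropy Q (Q.mat.mulVec p₀.1) p := by
  have hne : Q.mat.mulVec p.1 ≠ Q.mat.mulVec p₀.1 := fun h =>
    hp (Subtype.ext (hQ.mulVec_injective h))
  obtain ⟨b, hb⟩ := Function.ne_iff.1 hne
  rw [crossEntropy, crossEntropy, neg_lt_neg_iff, ← sub_neg, ← Finset.sum_sub_distrib]
  -- Zero is written as the difference of two total masses so that the inequality can be checked
  -- term by term.
  have h0 : ∑ β, (Q.mat.mulVec p.1 β - Q.mat.mulVec p₀.1 β) = 0 := by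
    rw [Finset.sum_sub_distrib, Q.sum_mulVec p.2, Q.sum_mulVec p₀.2, sub_self]
  rw [← h0]
  have e : ∀ β, Q.mat.mulVec p₀.1 β * Real.log (Q.mat.mulVec p.1 β) -
      Q.mat.mulVec p₀.1 β * Real.log (Q.mat.mulVec p₀.1 β) =
      Q.mat.mulVec p₀.1 β * Real.log (Q.mat.mulVec p.1 β / Q.mat.mulVec p₀.1 β) := fun β => by
    rw [Real.log_div (hQ.mulVec_pos β p.2).ne' (hQ.mulVec_pos β p₀.2).ne', mul_sub]
  have e' : ∀ β, Q.mat.mulVec p.1 β - Q.mat.mulVec p₀.1 β =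
      Q.mat.mulVec p₀.1 β * (Q.mat.mulVec p.1 β / Q.mat.mulVec p₀.1 β - 1) := fun β => by
    rw [mul_sub, mul_div_cancel₀ _ (hQ.mulVec_pos β p₀.2).ne', mul_one]
  refine Finset.sum_lt_sum (fun β _ => ?_) ⟨b, Finset.mem_univ b, ?_⟩
  · rw [e, e']
    exact mul_le_mul_of_nonneg_left (Real.log_le_sub_one_of_pos
      (div_pos (hQ.mulVec_pos β p.2) (hQ.mulVec_pos β p₀.2))) (hQ.mulVec_pos β p₀.2).le
  · rw [e, e']
    refine mul_lt_mul_of_pos_left (Real.log_lt_sub_one_of_pos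
      (div_pos (hQ.mulVec_pos b p.2) (hQ.mulVec_pos b p₀.2)) ?_) (hQ.mulVec_pos b p₀.2)
    rw [Ne, div_eq_one_iff_eq (hQ.mulVec_pos b p₀.2).ne']
    exact hb

/-- The relative frequencies of the perturbed data. -/
noncomputable def frequency {B : Type*} {n : ℕ} (y : Fin n → B) (β : B) : ℝ := tally y β / n

theorem objective_tally_eq {n : ℕ} (y : Fin n → B) (p : stdSimplex ℝ A) :
    objective Q (tally y) p.1 = n * crossEntropy Q (frequency y) p := by
  rw [objective, crossEntropy, mul_neg, Finset.mul_sum]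
  congr 1
  refine Finset.sum_congr rfl fun β _ => ?_
  rw [← mul_assoc, frequency]
  congr 1
  -- For `n = 0` the frequency is `0 / 0 = 0`, which agrees with the empty tally.
  rcases n with _ | n
  · simp [tally]
  · rw [mul_div_cancel₀]
    positivity

variable [MeasurableSpace A] [MeasurableSingletonClass A] [MeasurableSpace B]
  [MeasurableSingletonClass B]

theorem tendsto_mle (hQ : Q.IsRegular) {y : ∀ n, Fin n → B} {p₀ : stdSimplex ℝ A}
    (hy : ∀ β, Tendsto (fun n => frequency (y n) β) atTop (𝓝 (Q.mat.mulVec p₀.1 β)))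
    {p : ℕ → stdSimplex ℝ A} (hp : ∀ n, IsMLE Q (y n) (p n)) : Tendsto p atTop (𝓝 p₀) := by
  refine tendsto_of_minimizes (continuous_crossEntropy hQ _) (tendstoUniformly_crossEntropy hQ hy)
    (fun p hp => crossEntropy_lt hQ hp) ?_
  filter_upwards [eventually_gt_atTop 0] with n hn
  have h := (isMLE_iff_isMinOn hQ _ _).1 (hp n) p₀.2
  change objective Q (tally (y n)) (p n).1 ≤ objective Q (tally (y n)) p₀.1 at h
  rw [objective_tally_eq, objective_tally_eq] at h
  exact le_of_mul_le_mul_left h (by exact_mod_cast hn)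

theorem tendsto_posteriorMean (hQ : Q.IsRegular) {μ : Measure (stdSimplex ℝ A)}
    [IsProbabilityMeasure μ] {y : ∀ n, Fin n → B} {p₀ : stdSimplex ℝ A} (hp₀ : p₀ ∈ μ.support)
    (hy : ∀ β, Tendsto (fun n => frequency (y n) β) atTop (𝓝 (Q.mat.mulVec p₀.1 β))) :
    Tendsto (fun n => posteriorMean Q μ n (y n)) atTop (𝓝 p₀.1) := by
  refine tendsto_pi_nhds.2 fun x => ?_
  simp only [posteriorMean_eq, likelihood_eq_exp hQ, objective_tally_eq]
  exact tendsto_gibbs_integral (continuous_crossEntropy hQ _)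
    (fun n => continuous_crossEntropy hQ _) (tendstoUniformly_crossEntropy hQ hy)
    (fun p hp => crossEntropy_lt hQ hp) hp₀ (continuous_coord x)

/-- The strong law of large numbers for the indicators of `Y_i = β`, whose mean is `(Q p)_β`. -/
theorem ae_tendsto_frequency (hQ : Q.IsRegular) (p : stdSimplex ℝ A) :
    ∀ᵐ w ∂(dataKernel Q p), ∀ β,
      Tendsto (fun n => frequency (perturbed n w) β) atTop (𝓝 (Q.mat.mulVec p.1 β)) := by
  classical
  refine ae_all_iff.2 fun β => ?_
  let φ : A × B → ℝ := fun q => if q.2 = β then 1 else 0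
  have hφ : Measurable φ := measurable_of_finite φ
  have hmp : ∀ i, MeasurePreserving (fun w : ℕ → A × B => w i) (dataKernel Q p) (userLaw Q p) :=
    fun i => measurePreserving_eval_infinitePi (fun _ : ℕ => userLaw Q p) i
  have hindep : iIndepFun (fun (i : ℕ) (w : ℕ → A × B) => φ (w i)) (dataKernel Q p) :=
    iIndepFun_infinitePi (P := fun _ : ℕ => userLaw Q p) (X := fun _ => φ) fun _ => hφ
  have hmeas : ∀ i : ℕ, Measurable fun w : ℕ → A × B => φ (w i) := fun i =>
    hφ.comp (measurable_pi_apply i)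
  have hint : Integrable (fun w : ℕ → A × B => φ (w 0)) (dataKernel Q p) := by
    refine Integrable.of_bound (hmeas 0).aestronglyMeasurable 1 (ae_of_all _ fun w => ?_)
    simp only [φ]
    split_ifs <;> simp
  have hident : ∀ i : ℕ, IdentDistrib (fun w : ℕ → A × B => φ (w i)) (fun w => φ (w 0))
      (dataKernel Q p) (dataKernel Q p) := fun i =>
    ⟨(hmeas i).aemeasurable, (hmeas 0).aemeasurable, by
      rw [← Function.comp_def φ, ← Function.comp_def φ, ← Measure.map_map hφ (hmp i).measurable,
        ← Measure.map_map hφ (hmp 0).measurable, (hmp i).map_eq, (hmp 0).map_eq]⟩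
  have hmean : ∫ w, φ (w 0) ∂(dataKernel Q p) = Q.mat.mulVec p.1 β := by
    have h1 : ∫ w, φ (w 0) ∂(dataKernel Q p) = ∫ q, φ q ∂(userLaw Q p) := by
      rw [← (hmp 0).map_eq, integral_map (hmp 0).measurable.aemeasurable
        hφ.aestronglyMeasurable]
    have h2 : φ = Set.indicator {q | q.2 = β} 1 := by
      funext q
      simp [φ, Set.indicator_apply]
    rw [h1, h2, integral_indicator_one (Set.toFinite _).measurableSet, Measure.real,
      userLaw_snd_eq, ENNReal.toReal_ofReal (hQ.mulVec_pos β p.2).le]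
  have hlaw := strong_law_ae_real _ hint (fun i j hij => hindep.indepFun hij) hident
  rw [hmean] at hlaw
  filter_upwards [hlaw] with w hw
  refine hw.congr fun n => ?_
  rw [frequency, Finset.sum_range, tally]
  congr 1
  simp only [φ, Finset.sum_boole, perturbed]
  congr!

end Consistency

end LDP

namespace LDP

/-! ### From almost sure convergence to convergence in probability -/

section Convergence

variable {A B : Type*} [Fintype A] [Fintype B] [MeasurableSpace A] [MeasurableSingletonClass A]
  [MeasurableSpace B] [MeasurableSingletonClass B] {Q : PrivacyProtocol A B}
  {μ : Measure (stdSimplex ℝ A)} [IsProbabilityMeasure μ]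

theorem ae_tendsto_mle_sub_posteriorMean (hQ : Q.IsRegular)
    {est : ∀ n : ℕ, (Fin n → B) → stdSimplex ℝ A} (hest : ∀ n y, IsMLE Q y (est n y))
    {p : stdSimplex ℝ A} (hp : p ∈ μ.support) :
    ∀ᵐ w ∂(dataKernel Q p), Tendsto (fun n => (est n (perturbed n w)).1 -
      posteriorMean Q μ n (perturbed n w)) atTop (𝓝 0) := by
  filter_upwards [ae_tendsto_frequency hQ p] with w hw
  rw [← sub_self p.1]
  exact ((continuous_subtype_val.tendsto p).comp
    (tendsto_mle hQ hw fun n => hest n (perturbed n w))).sub (tendsto_posteriorMean hQ hp hw)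

theorem measurable_comp_perturbed {A B E : Type*} [Fintype B] [MeasurableSpace A]
    [MeasurableSpace B] [MeasurableSingletonClass B] [MeasurableSpace E] {n : ℕ}
    (F : (Fin n → B) → E) : Measurable fun w : ℕ → A × B => F (perturbed n w) :=
  (measurable_of_finite F).comp (measurable_perturbed n)

theorem tendstoInMeasure_dataKernel (hQ : Q.IsRegular)
    {est : ∀ n : ℕ, (Fin n → B) → stdSimplex ℝ A} (hest : ∀ n y, IsMLE Q y (est n y))
    {p : stdSimplex ℝ A} (hp : p ∈ μ.support) :
    TendstoInMeasure (dataKernel Q p) (fun (n : ℕ) w => (est n (perturbed n w)).1 -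
      posteriorMean Q μ n (perturbed n w)) atTop (fun _ => 0) :=
  tendstoInMeasure_of_tendsto_ae (fun n => (measurable_comp_perturbed
      fun y => (est n y).1 - posteriorMean Q μ n y).aestronglyMeasurable)
    (ae_tendsto_mle_sub_posteriorMean hQ hest hp)

theorem tendstoInMeasure_jointLaw (hQ : Q.IsRegular)
    {est : ∀ n : ℕ, (Fin n → B) → stdSimplex ℝ A} (hest : ∀ n y, IsMLE Q y (est n y)) :
    TendstoInMeasure (jointLaw Q μ) (fun (n : ℕ) ω => (est n (perturbed n ω.2)).1 -
      posteriorMean Q μ n (perturbed n ω.2)) atTop (fun _ => 0) := by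
  have hm : ∀ n : ℕ, Measurable fun ω : stdSimplex ℝ A × (ℕ → A × B) =>
      (est n (perturbed n ω.2)).1 - posteriorMean Q μ n (perturbed n ω.2) := fun n =>
    (measurable_comp_perturbed fun y => (est n y).1 - posteriorMean Q μ n y).comp measurable_snd
  refine tendstoInMeasure_of_tendsto_ae (fun n => (hm n).aestronglyMeasurable) ?_
  -- The conditional statement holds for `p` in the support, which has full prior measure;
  -- measurability of the convergence event lets it pass to the joint law.
  refine Measure.ae_compProd_of_ae_ae (measurableSet_tendsto _ hm) ?_
  filter_upwards [Measure.support_mem_ae (μ := μ)] with p hp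
  exact ae_tendsto_mle_sub_posteriorMean hQ hest hp

end Convergence

end LDP

theorem mainTheorem8 {A B : Type*} [Fintype A] [Nonempty A] [Fintype B]
    [MeasurableSpace A] [MeasurableSingletonClass A]
    [MeasurableSpace B] [MeasurableSingletonClass B] :
    (∀ Q : LDP.PrivacyProtocol A B, Q.IsRegular →
      -- maximum likelihood estimates exist
      (∀ (n : ℕ) (y : Fin n → B), ∃ p, LDP.IsMLE Q y p) ∧
      -- for every prior, the posterior mean is the unique optimal estimator, and every maximum
      -- likelihood estimator converges to the optimal one in probability, both under the joint law
      -- and under the conditional law given `P = p`, for each `p` in the support of the prior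
      (∀ (μ : Measure (stdSimplex ℝ A)) [IsProbabilityMeasure μ],
        (∀ (n : ℕ) (est : (Fin n → B) → A → ℝ),
          LDP.IsOptimalEstimator Q μ n est ↔ est = LDP.posteriorMean Q μ n) ∧
        ∀ (PiMLE : ∀ n : ℕ, (Fin n → B) → stdSimplex ℝ A)
          (PiOpt : ∀ n : ℕ, (Fin n → B) → A → ℝ),
          (∀ n y, LDP.IsMLE Q y (PiMLE n y)) →
          (∀ n, LDP.IsOptimalEstimator Q μ n (PiOpt n)) →
          TendstoInMeasure (LDP.jointLaw Q μ)
            (fun (n : ℕ) ω => (PiMLE n (LDP.perturbed n ω.2) : A → ℝ)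
              - PiOpt n (LDP.perturbed n ω.2)) atTop (fun _ => 0) ∧
          ∀ p ∈ μ.support,
            TendstoInMeasure (LDP.dataKernel Q p)
              (fun (n : ℕ) w => (PiMLE n (LDP.perturbed n w) : A → ℝ)
                - PiOpt n (LDP.perturbed n w)) atTop (fun _ => 0)) ∧
      -- maximum likelihood estimates are the solutions of a convex problem of dimension `a - 1`
      Module.finrank ℝ (vectorSpan ℝ (stdSimplex ℝ A)) = Fintype.card A - 1 ∧
      (∀ (n : ℕ) (y : Fin n → B),
        ConvexOn ℝ (stdSimplex ℝ A) (LDP.objective Q (LDP.tally y)) ∧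
        ∀ p : stdSimplex ℝ A, LDP.IsMLE Q y p ↔
          IsMinOn (LDP.objective Q (LDP.tally y)) (stdSimplex ℝ A) (p : A → ℝ))) ∧
    -- one program solves all these problems, in a running time independent of `n` and `y`
    (∃ prog : LDP.RealProgram (LDP.Register A B),
      ∀ Q : LDP.PrivacyProtocol A B, Q.IsRegular → ∀ ε : ℝ, 0 < ε →
        ∃ T : ℕ, ∀ (n : ℕ) (y : Fin n → B),
          ∃ (final : LDP.Register A B → ℝ) (t : ℕ),
            prog.RunsIn (LDP.initialState Q (LDP.tally y) ε) final t ∧ t ≤ T ∧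
            LDP.IsApproxMinimizer ε (stdSimplex ℝ A) (LDP.objective Q (LDP.tally y))
              (fun x => final (.output x))) := by
  refine ⟨fun Q hQ => ⟨fun n y => LDP.exists_isMLE hQ y, fun μ hμ =>
    ⟨fun n est => LDP.isOptimalEstimator_iff hQ n est, fun PiMLE PiOpt hMLE hOpt => ?_⟩,
    LDP.finrank_vectorSpan_stdSimplex A,
    fun n y => ⟨hQ.convexOn_objective _, fun p => LDP.isMLE_iff_isMinOn hQ y p⟩⟩, ?_⟩
  · obtain rfl : PiOpt = LDP.posteriorMean Q μ :=
      funext fun n => (LDP.isOptimalEstimator_iff hQ n _).1 (hOpt n)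
    exact ⟨LDP.tendstoInMeasure_jointLaw hQ hMLE,
      fun p hp => LDP.tendstoInMeasure_dataKernel hQ hMLE hp⟩
  · obtain ⟨prog, h⟩ := LDP.exists_program (A := A) (B := B)
    refine ⟨prog, fun Q hQ ε hε => ?_⟩
    obtain ⟨T, hT⟩ := h Q hQ ε hε
    exact ⟨T, fun n y => hT (LDP.tally y)⟩
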